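/- Let $N\ge 2$ and $K$ be natural numbers, and let $m_k(i)\in(0,1)$ ($1\le k\le K$, $1\le i\le N$) satisfy $\sum_{k=1}^K m_k(i)^2=1$ for every $i$ and $m_k(i_1)\ne m_k(i_2)$ for every $k$ and all $i_1\neq i_2$. Put $M_k=\mathrm{diag}(m_k(1),\dots,m_k(N))$. Let $\mathcal S_N=\{\phi\in\mathbb C^N:\|\phi\|=1\}$ (Euclidean norm) carry its Riemannian surface measure $\sigma$, as the sphere $\mathbb S^{2N-1}$. Consider the Markov process $\Phi_{n+1}=M_{\kappa_n}\Phi_n/\|M_{\kappa_n}\Phi_n\|$ on $\mathcal S_N$, where, given $\Phi_n=\phi$, the outcome $\kappa_n=k$ has probability $\|M_k\phi\|^2$; its transition probabilities are $$P(\phi,A)=\sum_{k=1}^K\|M_k\phi\|^2\,1_A\!\left(\frac{M_k\phi}{\|M_k\phi\|}\right).$$ Let $\mathcal P:L^1(\sigma)\to L^1(\sigma)$ (real functions) be its Frobenius--Perron operator: the positive linear contraction that sends $f$ to the Radon--Nikodym derivative with respect to $\sigma$ of the signed measure $A\mapsto\int f(\phi)P(\phi,A)\,d\sigma(\phi)$.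 Extend $\mathcal P$ to nonnegative measurable functions $u$ by $\mathcal Pu=\lim_n\mathcal Pu_n$, where $0\le u_n\in L^1(\sigma)$ increases to $u$. Then: 1. $\int_A\mathcal Pf\,d\sigma=\int f(\phi)\,P(\phi,A)\,d\sigma(\phi)$ for all $f\in L^1(\sigma)$ and all measurable $A\subset\mathcal S_N$. 2. For $\rho(\phi)=1/\prod_{i=1}^N|\phi_i|^2$ and $\sigma$-almost every $\phi$, $$\mathcal P\rho(\phi)=\Big(\sum_{k=1}^K\frac1{\|M_k^{-1}\phi\|^2}\Big)\rho(\phi).$$ 3. $\rho$ is properly subinvariant: it is measurable and finite almost everywhere, and $\mathcal P\rho<\rho$ almost everywhere. 4. The process is sweeping to $\Lambda=\bigcup_{i=1}^N\{\phi\in\mathcal S_N:\phi_i=0\}$. That is, $\Lambda\ne\emptyset$, and there is a countable family $\mathcal A$ of (relatively) open subsets of $\mathcal S_N$ which is admissible (its members have finite measure, it is closed under unions of two members, and countably many members cover $\mathcal S_N$ up to a null set), such that $\bigcap_{A\in\mathcal A}A^c=\Lambda$ and $$\lim_{n\to\infty}\int_A\mathcal P^nf\,d\sigma=0\qquad\text{for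 all }A\in\mathcal A\text{ and } f\in L^1(\sigma).$$ -/

import Mathlib

open MeasureTheory ProbabilityTheory Filter Topology
open scoped ENNReal ComplexOrder

noncomputable section

namespace DualLyapunov

section General

variable {X : Type*} [MeasurableSpace X]

/-- A Markov operator on `L¹(m)`: a linear positive contraction. -/
structure MarkovOperator (m : Measure X) where
  /-- the underlying (bounded) linear operator -/
  toCLM : Lp ℝ 1 m →L[ℝ] Lp ℝ 1 m
  contraction : ∀ f, ‖toCLM f‖ ≤ ‖f‖
  positive : ∀ f, 0 ≤ f → 0 ≤ toCLM f

/-- An admissible family of measurable sets: sets of finite measure, closed under finite unions,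
with a countable subfamily covering the space up to a null set. -/
structure IsAdmissible (m : Measure X) (𝒜 : Set (Set X)) : Prop where
  measurable : ∀ A ∈ 𝒜, MeasurableSet A
  finite : ∀ A ∈ 𝒜, m A < ∞
  union : ∀ A ∈ 𝒜, ∀ B ∈ 𝒜, A ∪ B ∈ 𝒜
  cover : ∃ A : ℕ → Set X, (∀ n, A n ∈ 𝒜) ∧ m (⋃ n, A n)ᶜ = 0

/-- The truncations `min u n` restricted to the `n`-th set of an increasing exhaustion of `X` by
sets of finite measure; they increase pointwise to `u` (where `u = ∞` as well). -/
def truncation (m : Measure X) [SigmaFinite m] (u : X → ℝ≥0∞) (n : ℕ) : X → ℝ :=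
  (spanningSets m n).indicator fun x => (min (u x) n).toReal

theorem integrable_truncation (m : Measure X) [SigmaFinite m] {u : X → ℝ≥0∞}
    (hu : AEMeasurable u m) (n : ℕ) : Integrable (truncation m u n) m := by
  refine IntegrableOn.integrable_indicator ?_ (measurableSet_spanningSets m n)
  refine Measure.integrableOn_of_bounded (M := n) (measure_spanningSets_lt_top m n).ne
    (hu.min aemeasurable_const).ennreal_toReal.aestronglyMeasurable
    (Eventually.of_forall fun x => ?_)
  rw [Real.norm_of_nonneg ENNReal.toReal_nonneg]
  simpa using ENNReal.toReal_mono (by simp) (min_le_right (u x) (n : ℝ≥0∞))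

open Classical in
/-- The truncations as elements of `L¹(m)` (for non-measurable `u` the value `0` is used). -/
def truncationL1 (m : Measure X) [SigmaFinite m] (u : X → ℝ≥0∞) (n : ℕ) : Lp ℝ 1 m :=
  if hu : AEMeasurable u m then (integrable_truncation m hu n).toL1 _ else 0

namespace MarkovOperator

variable {m : Measure X} (P : MarkovOperator m)

/-- The monotone extension of a Markov operator to nonnegative measurable functions: the limit
of `P uₙ` for an increasing sequence of nonnegative integrable `uₙ` tending to `u`. The sequence
`P uₙ` is a.e. increasing, so the limit is a supremum. -/
def extend [SigmaFinite m] (u : X → ℝ≥0∞) : X → ℝ≥0∞ :=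
  fun x => ⨆ n, ENNReal.ofReal (P.toCLM (truncationL1 m u n) x)

/-- `u` is a measurable, (a.e.) finite, nonnegative function with `P u < u` a.e. -/
structure IsProperlySubinvariant [SigmaFinite m] (u : X → ℝ≥0∞) : Prop where
  aemeasurable : AEMeasurable u m
  finite : ∀ᵐ x ∂m, u x < ∞
  lt : ∀ᵐ x ∂m, P.extend u x < u x

/-- `P` is sweeping with respect to the family `𝒜`. -/
def IsSweeping (𝒜 : Set (Set X)) : Prop :=
  ∀ A ∈ 𝒜, ∀ f : Lp ℝ 1 m, Tendsto (fun n : ℕ => ∫ x in A, (P.toCLM ^ n) f x ∂m) atTop (𝓝 0)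

/-- `P` is sweeping to the nonempty set `Λ`: it is sweeping with respect to an admissible family
of countably many open sets, the intersection of whose complements is exactly `Λ`. -/
def IsSweepingTo [TopologicalSpace X] (Λ : Set X) : Prop :=
  Λ.Nonempty ∧ ∃ 𝒜 : Set (Set X), 𝒜.Countable ∧ (∀ A ∈ 𝒜, IsOpen A) ∧ IsAdmissible m 𝒜 ∧
    (⋂ A ∈ 𝒜, Aᶜ) = Λ ∧ P.IsSweeping 𝒜

end MarkovOperator

/-! ### The Frobenius–Perron operator of a transition kernel -/

section FrobeniusPerron

variable (m : Measure X) (κ : Kernel X X)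

/-- The density of `A ↦ ∫ u(x) κ(x, A) dm(x)`, for a nonnegative function `u`. -/
def perronDensity (u : X → ℝ≥0∞) : X → ℝ≥0∞ :=
  (κ ∘ₘ m.withDensity u).rnDeriv m

/-- The density of `A ↦ ∫ f(x) κ(x, A) dm(x)`, for a real function `f`. -/
def perronFun (f : X → ℝ) : X → ℝ := fun x =>
  (perronDensity m κ (fun y => ENNReal.ofReal (f y)) x).toReal -
    (perronDensity m κ (fun y => ENNReal.ofReal (-f y)) x).toReal

variable {m} {κ}

theorem lintegral_perronDensity_le [IsMarkovKernel κ] (u : X → ℝ≥0∞) :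
    ∫⁻ x, perronDensity m κ u x ∂m ≤ ∫⁻ x, u x ∂m := by
  refine (Measure.lintegral_rnDeriv_le).trans ?_
  rw [Measure.bind_apply MeasurableSet.univ κ.aemeasurable]
  simp

theorem perronDensity_add [SigmaFinite m] [IsMarkovKernel κ] {u v : X → ℝ≥0∞}
    (hu : AEMeasurable u m) (hui : ∫⁻ x, u x ∂m ≠ ∞) (hvi : ∫⁻ x, v x ∂m ≠ ∞) :
    perronDensity m κ (u + v) =ᵐ[m] perronDensity m κ u + perronDensity m κ v := by
  have := isFiniteMeasure_withDensity hui
  have := isFiniteMeasure_withDensity hvi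
  unfold perronDensity
  have e : m.withDensity (u + v) = m.withDensity u + m.withDensity v := by
    refine Measure.ext fun s hs => ?_
    rw [Measure.add_apply, withDensity_apply _ hs, withDensity_apply _ hs, withDensity_apply _ hs]
    exact lintegral_add_left' hu.restrict _
  rw [e, Measure.comp_add]
  exact Measure.rnDeriv_add _ _ _

theorem perronDensity_congr {u v : X → ℝ≥0∞} (h : u =ᵐ[m] v) :
    perronDensity m κ u = perronDensity m κ v := by
  unfold perronDensity
  rw [withDensity_congr_ae h]

theorem perronDensity_lt_top [IsMarkovKernel κ] {u : X → ℝ≥0∞}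
    (hui : ∫⁻ x, u x ∂m ≠ ∞) : ∀ᵐ x ∂m, perronDensity m κ u x < ∞ :=
  ae_lt_top (Measure.measurable_rnDeriv _ _)
    (ne_top_of_le_ne_top hui (lintegral_perronDensity_le u))

theorem lintegral_ofReal_ne_top {f : X → ℝ} (hf : Integrable f m) :
    ∫⁻ x, ENNReal.ofReal (f x) ∂m ≠ ∞ :=
  (hf.lintegral_lt_top).ne

theorem integrable_perronFun [IsMarkovKernel κ] {f : X → ℝ} (hf : Integrable f m) :
    Integrable (perronFun m κ f) m := by
  refine Integrable.sub ?_ ?_ <;>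
  refine integrable_toReal_of_lintegral_ne_top (Measure.measurable_rnDeriv _ _).aemeasurable
    (ne_top_of_le_ne_top ?_ (lintegral_perronDensity_le _))
  · exact lintegral_ofReal_ne_top hf
  · exact lintegral_ofReal_ne_top hf.neg

theorem perronFun_congr {f g : X → ℝ} (h : f =ᵐ[m] g) : perronFun m κ f = perronFun m κ g := by
  have h1 : (fun y => ENNReal.ofReal (f y)) =ᵐ[m] fun y => ENNReal.ofReal (g y) := by
    filter_upwards [h] with x hx using by rw [hx]
  have h2 : (fun y => ENNReal.ofReal (-f y)) =ᵐ[m] fun y => ENNReal.ofReal (-g y) := by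
    filter_upwards [h] with x hx using by rw [hx]
  unfold perronFun
  rw [perronDensity_congr h1, perronDensity_congr h2]

theorem perronFun_add [SigmaFinite m] [IsMarkovKernel κ] {f g : X → ℝ} (hf : Integrable f m)
    (hg : Integrable g m) : perronFun m κ (f + g) =ᵐ[m] perronFun m κ f + perronFun m κ g := by
  let p : (X → ℝ) → X → ℝ≥0∞ := fun h y => ENNReal.ofReal (h y)
  have hm : ∀ {h : X → ℝ}, Integrable h m → AEMeasurable (p h) m :=
    fun h => h.1.aemeasurable.ennreal_ofReal
  have hi : ∀ {h : X → ℝ}, Integrable h m → ∫⁻ x, p h x ∂m ≠ ∞ := fun h =>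
    lintegral_ofReal_ne_top h
  have hs : ∀ {h k : X → ℝ}, Integrable h m → Integrable k m →
      ∫⁻ x, (p h + p k) x ∂m ≠ ∞ := fun h k => by
    simp only [Pi.add_apply]
    rw [lintegral_add_left' (hm h)]
    exact ENNReal.add_ne_top.2 ⟨hi h, hi k⟩
  have hfg := hf.add hg
  have key : p (f + g) + (p (-f) + p (-g)) = p (-(f + g)) + (p f + p g) := by
    funext y
    have e : ∀ r : ℝ, ENNReal.ofReal r = ENNReal.ofReal (max r 0) := fun r => by
      rcases le_total r 0 with h | h
      · simp [h]
      · simp [h]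
    simp only [p, Pi.add_apply, Pi.neg_apply]
    rw [e (f y + g y), e (-f y), e (-g y), e (-(f y + g y)), e (f y), e (g y)]
    rw [← ENNReal.ofReal_add, ← ENNReal.ofReal_add, ← ENNReal.ofReal_add, ← ENNReal.ofReal_add]
    · congr 1
      have h0 : ∀ r : ℝ, max r 0 - max (-r) 0 = r := fun r => by
        rcases le_total r 0 with h | h
        · rw [max_eq_right h, max_eq_left (by linarith)]; ring
        · rw [max_eq_left h, max_eq_right (by linarith)]; ring
      linarith [h0 (f y), h0 (g y), h0 (f y + g y)]
    all_goals positivity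
  have e1 := perronDensity_add (κ := κ) (hm hfg) (hi hfg) (hs hf.neg hg.neg)
  have e2 := perronDensity_add (κ := κ) (hm hf.neg) (hi hf.neg) (hi hg.neg)
  have e3 := perronDensity_add (κ := κ) (hm hfg.neg) (hi hfg.neg) (hs hf hg)
  have e4 := perronDensity_add (κ := κ) (hm hf) (hi hf) (hi hg)
  rw [key] at e1
  filter_upwards [e1, e2, e3, e4, perronDensity_lt_top (κ := κ) (hi hf),
    perronDensity_lt_top (κ := κ) (hi hg), perronDensity_lt_top (κ := κ) (hi hfg),
    perronDensity_lt_top (κ := κ) (hi hf.neg), perronDensity_lt_top (κ := κ) (hi hg.neg),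
    perronDensity_lt_top (κ := κ) (hi hfg.neg)] with x h1 h2 h3 h4 f1 f2 f3 f4 f5 f6
  simp only [Pi.add_apply] at h1 h2 h3 h4
  rw [h2] at h1
  rw [h4, h1] at h3
  have h5 := congrArg ENNReal.toReal h3
  rw [ENNReal.toReal_add f3.ne (ENNReal.add_ne_top.2 ⟨f4.ne, f5.ne⟩),
    ENNReal.toReal_add f4.ne f5.ne,
    ENNReal.toReal_add f6.ne (ENNReal.add_ne_top.2 ⟨f1.ne, f2.ne⟩),
    ENNReal.toReal_add f1.ne f2.ne] at h5
  change (perronDensity m κ (p (f + g)) x).toReal - (perronDensity m κ (p (-(f + g))) x).toReal =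
    ((perronDensity m κ (p f) x).toReal - (perronDensity m κ (p (-f)) x).toReal) +
    ((perronDensity m κ (p g) x).toReal - (perronDensity m κ (p (-g)) x).toReal)
  linarith

theorem integral_norm_perronFun_le [IsMarkovKernel κ] {f : X → ℝ} (hf : Integrable f m) :
    ∫ x, ‖perronFun m κ f x‖ ∂m ≤ ∫ x, ‖f x‖ ∂m := by
  rw [integral_norm_eq_lintegral_enorm (integrable_perronFun hf).1,
    integral_norm_eq_lintegral_enorm hf.1]
  refine ENNReal.toReal_mono hf.2.ne ?_
  have h1 : ∀ x, ‖perronFun m κ f x‖ₑ ≤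
      perronDensity m κ (fun y => ENNReal.ofReal (f y)) x +
        perronDensity m κ (fun y => ENNReal.ofReal (-f y)) x := fun x => by
    refine (enorm_sub_le).trans (add_le_add ?_ ?_) <;>
    · rw [Real.enorm_of_nonneg ENNReal.toReal_nonneg]
      exact ENNReal.ofReal_toReal_le
  refine (lintegral_mono h1).trans ?_
  rw [lintegral_add_left (by exact Measure.measurable_rnDeriv _ _)]
  refine (add_le_add (lintegral_perronDensity_le _) (lintegral_perronDensity_le _)).trans ?_
  rw [← lintegral_add_left' hf.1.aemeasurable.ennreal_ofReal]
  refine lintegral_mono fun x => ?_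
  rcases le_total (f x) 0 with h | h
  · simp [ENNReal.ofReal_of_nonpos h, Real.enorm_eq_ofReal_abs, abs_of_nonpos h]
  · simp [ENNReal.ofReal_of_nonpos (neg_nonpos.2 h), Real.enorm_eq_ofReal_abs, abs_of_nonneg h]

variable (m) (κ)

/-- `perronFun` on `L¹(m)`, as an additive map. -/
def perronAddHom [SigmaFinite m] [IsMarkovKernel κ] : Lp ℝ 1 m →+ Lp ℝ 1 m :=
  AddMonoidHom.mk' (fun f => (integrable_perronFun (κ := κ) (L1.integrable_coeFn f)).toL1 _)
    fun f g => by
      rw [← Integrable.toL1_add]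
      refine (Integrable.toL1_eq_toL1_iff _ _ _ _).2 ?_
      rw [perronFun_congr (Lp.coeFn_add f g)]
      exact perronFun_add (L1.integrable_coeFn f) (L1.integrable_coeFn g)

variable {m} {κ} in
theorem norm_perronAddHom_le [SigmaFinite m] [IsMarkovKernel κ] (f : Lp ℝ 1 m) :
    ‖perronAddHom m κ f‖ ≤ ‖f‖ := by
  rw [L1.norm_eq_integral_norm, L1.norm_eq_integral_norm]
  refine le_trans (le_of_eq (integral_congr_ae ?_))
    (integral_norm_perronFun_le (κ := κ) (L1.integrable_coeFn f))
  filter_upwards [Integrable.coeFn_toL1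
    (integrable_perronFun (κ := κ) (L1.integrable_coeFn f))] with x hx
  exact congrArg norm hx

/-- The Frobenius–Perron operator of the Markov process with transition probabilities
`κ(x, A)`: the Markov operator sending `f ∈ L¹(m)` to the Radon–Nikodym derivative with respect to
`m` of the (signed) measure `A ↦ ∫ f(x) κ(x, A) dm(x)`. -/
def frobeniusPerron [SigmaFinite m] [IsMarkovKernel κ] : MarkovOperator m where
  toCLM := (perronAddHom m κ).toRealLinearMap
    (AddMonoidHomClass.continuous_of_bound _ 1 fun f => by
      simpa using norm_perronAddHom_le f)
  contraction f := norm_perronAddHom_le f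
  positive f hf := by
    rw [← Lp.coeFn_nonneg] at hf ⊢
    have h0 : perronDensity m κ (fun y => ENNReal.ofReal (-f y)) =ᵐ[m] 0 := by
      have : (fun y => ENNReal.ofReal (-f y)) =ᵐ[m] 0 := by
        filter_upwards [hf] with x hx
        simpa using hx
      rw [perronDensity_congr this]
      have e : κ ∘ₘ m.withDensity 0 = 0 := by
        rw [withDensity_zero]
        simp
      unfold perronDensity
      rw [e]
      exact Measure.rnDeriv_zero _
    filter_upwards [h0, Integrable.coeFn_toL1
      (integrable_perronFun (κ := κ) (L1.integrable_coeFn f))] with x hx h1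
    change 0 ≤ (((integrable_perronFun (κ := κ) (L1.integrable_coeFn f)).toL1 _ : Lp ℝ 1 m) x)
    rw [h1, perronFun, hx]
    simp

end FrobeniusPerron

end General

/-! ### Quantum systems with non-demolition measurements -/

/-- The set of states: the unit sphere of `ℂ^N` for the Hermitian norm. -/
abbrev StateSphere (N : ℕ) : Type := Metric.sphere (0 : EuclideanSpace ℂ (Fin N)) 1

/-- The Riemannian (surface) measure of the unit sphere of `ℂ^N = ℝ^{2N}`. -/
abbrev stateMeasure (N : ℕ) : Measure (StateSphere N) :=
  (volume : Measure (EuclideanSpace ℂ (Fin N))).toSphere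

/-- The action of a matrix on `ℂ^N` with its Hermitian norm. -/
abbrev mulVecE {N : ℕ} (M : Matrix (Fin N) (Fin N) ℂ) (φ : EuclideanSpace ℂ (Fin N)) :
    EuclideanSpace ℂ (Fin N) :=
  Matrix.toEuclideanCLM (𝕜 := ℂ) M φ

/-- Measurement matrices `M₁, …, M_K` of an `N`-dimensional quantum system with non-demolition
measurements. -/
structure QNDSystem (N K : ℕ) where
  M : Fin K → Matrix (Fin N) (Fin N) ℂ
  posDef : ∀ k, (M k).PosDef
  complete : ∑ k, (M k).conjTranspose * M k = 1

namespace QNDSystem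

variable {N K : ℕ} (S : QNDSystem N K)

theorem mulVecE_ne_zero (k : Fin K) (φ : StateSphere N) : mulVecE (S.M k) φ ≠ 0 := by
  intro h
  have h1 : mulVecE ((S.M k)⁻¹) (mulVecE (S.M k) φ) = φ := by
    change (Matrix.toEuclideanCLM (𝕜 := ℂ) (S.M k)⁻¹ * Matrix.toEuclideanCLM (𝕜 := ℂ) (S.M k))
      (φ : EuclideanSpace ℂ (Fin N)) = φ
    rw [← map_mul, Matrix.nonsing_inv_mul _ ((Matrix.isUnit_iff_isUnit_det _).1 (S.posDef k).isUnit)]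
    simp
  rw [h] at h1
  exact ne_zero_of_mem_unit_sphere φ (h1.symm.trans (map_zero (Matrix.toEuclideanCLM (𝕜 := ℂ) (S.M k)⁻¹)))

/-- The non-demolition measurement operator `φ ↦ M_k φ / ‖M_k φ‖` on the sphere. -/
def update (k : Fin K) (φ : StateSphere N) : StateSphere N :=
  ⟨((‖mulVecE (S.M k) φ‖⁻¹ : ℝ) : ℂ) • mulVecE (S.M k) φ, by
    have := norm_ne_zero_iff.2 (S.mulVecE_ne_zero k φ)
    rw [mem_sphere_zero_iff_norm, norm_smul, Complex.norm_real, norm_inv, norm_norm,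
      inv_mul_cancel₀ this]⟩

/-- The probability `p_k(φ) = ‖M_k φ‖²` of the outcome `k` in the state `φ`. -/
def prob (k : Fin K) (φ : StateSphere N) : ℝ := ‖mulVecE (S.M k) φ‖ ^ 2

theorem continuous_update (k : Fin K) : Continuous (S.update k) := by
  have h : Continuous fun φ : StateSphere N => mulVecE (S.M k) φ := by fun_prop
  refine Continuous.subtype_mk ?_ _
  exact (Complex.continuous_ofReal.comp
    (h.norm.inv₀ fun φ => norm_ne_zero_iff.2 (S.mulVecE_ne_zero k φ))).smul h

theorem continuous_prob (k : Fin K) : Continuous (S.prob k) := by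
  unfold prob
  fun_prop

theorem sum_prob (φ : StateSphere N) : ∑ k, S.prob k φ = 1 := by
  have h : ∀ k, (S.prob k φ : ℂ) =
      inner ℂ (φ : EuclideanSpace ℂ (Fin N)) (mulVecE ((S.M k).conjTranspose * S.M k) φ) := by
    intro k
    have e : mulVecE ((S.M k).conjTranspose * S.M k) (φ : EuclideanSpace ℂ (Fin N)) =
        ContinuousLinearMap.adjoint (Matrix.toEuclideanCLM (𝕜 := ℂ) (S.M k))
          (mulVecE (S.M k) φ) := by
      rw [← ContinuousLinearMap.star_eq_adjoint, ← map_star, Matrix.star_eq_conjTranspose]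
      simp [mulVecE]
    rw [e, ContinuousLinearMap.adjoint_inner_right, inner_self_eq_norm_sq_to_K]
    simp [prob]
  have h2 : ((∑ k, S.prob k φ : ℝ) : ℂ) = 1 := by
    push_cast
    simp_rw [h]
    rw [← inner_sum]
    have e : ∑ k, mulVecE ((S.M k).conjTranspose * S.M k) (φ : EuclideanSpace ℂ (Fin N)) = φ := by
      rw [← _root_.sum_apply, ← map_sum, S.complete]
      simp
    rw [e, inner_self_eq_norm_sq_to_K, norm_eq_of_mem_sphere]
    simp
  exact_mod_cast h2

/-- The transition probabilities `P(φ, A) = ∑ₖ p_k(φ) 1_A(M_k φ / ‖M_k φ‖)` of the process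
`Φₙ₊₁ = M_κ Φₙ / ‖M_κ Φₙ‖`, where the outcome `κ = k` has probability `p_k(Φₙ)`. -/
def transition : Kernel (StateSphere N) (StateSphere N) where
  toFun φ := ∑ k, ENNReal.ofReal (S.prob k φ) • Measure.dirac (S.update k φ)
  measurable' := by
    refine Measure.measurable_of_measurable_coe _ fun A hA => ?_
    simp only [Measure.coe_finsetSum, Finset.sum_apply, Measure.smul_apply, smul_eq_mul]
    refine Finset.measurable_sum _ fun k _ => Measurable.mul ?_ ?_
    · exact (S.continuous_prob k).measurable.ennreal_ofReal
    · exact (Measure.measurable_coe hA).comp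
        (Measure.measurable_dirac.comp (S.continuous_update k).measurable)

instance : IsMarkovKernel S.transition where
  isProbabilityMeasure φ := ⟨by
    change (∑ k, ENNReal.ofReal (S.prob k φ) • Measure.dirac (S.update k φ)) Set.univ = 1
    simp only [Measure.coe_finsetSum, Finset.sum_apply, Measure.smul_apply, smul_eq_mul,
      measure_univ, mul_one]
    rw [← ENNReal.ofReal_sum_of_nonneg (fun k _ => by unfold prob; positivity), S.sum_prob, ENNReal.ofReal_one]⟩

/-- The Frobenius–Perron operator of the system, on `L¹` of the sphere of states. -/
def perron : MarkovOperator (stateMeasure N) :=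
  frobeniusPerron (stateMeasure N) S.transition

/-- The system with the diagonal measurement matrices `M_k = diag(m_k(1), …, m_k(N))`. -/
def diagonal (m : Fin K → Fin N → ℝ) (hm : ∀ k i, m k i ∈ Set.Ioo (0 : ℝ) 1)
    (hsum : ∀ i, ∑ k, m k i ^ 2 = 1) : QNDSystem N K where
  M k := Matrix.diagonal fun i => (m k i : ℂ)
  posDef k := Matrix.PosDef.diagonal fun i => by exact_mod_cast (hm k i).1
  complete := by
    have h : ∀ k, (Matrix.diagonal fun i => (m k i : ℂ)).conjTranspose *
        Matrix.diagonal (fun i => (m k i : ℂ)) = Matrix.diagonal fun i => ((m k i ^ 2 : ℝ) : ℂ) := by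
      intro k
      rw [Matrix.diagonal_conjTranspose, Matrix.diagonal_mul_diagonal]
      congr 1
      funext i
      simp [sq]
    simp_rw [h]
    ext i j
    rw [Matrix.sum_apply]
    by_cases hij : i = j
    · subst hij
      simp only [Matrix.diagonal_apply_eq, Matrix.one_apply_eq]
      exact_mod_cast hsum i
    · simp [hij]

end QNDSystem

/-- `ρ(φ) = 1 / ∏ᵢ |φᵢ|²`, with the value `∞` where some coordinate vanishes. -/
def inverseProduct {N : ℕ} (φ : StateSphere N) : ℝ≥0∞ :=
  (∏ i, ENNReal.ofReal (‖(φ : EuclideanSpace ℂ (Fin N)) i‖ ^ 2))⁻¹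

end DualLyapunov

end

open DualLyapunov

open DualLyapunov

/-! The weight `ρ = 1 / ∏ |φ_i|²`, extended to `ℂ^N` as `invProd`, is homogeneous of degree `-2N`,
minus the real dimension. A diagonal `M_k` divides it by `∏ m_k(i)²`, which is also the real
Jacobian of `M_k`. These two facts make `ρ σ` invariant under every normalised map `φ ↦ M_k φ / ‖M_k
φ‖` (`lintegral_inverseProduct_mul_comp_update`), with no Jacobian computed on the sphere itself.

Invariance gives the Frobenius–Perron operator explicitly: each branch transports `u p_k / ρ` along
the inverse update, and the sum is multiplied by `ρ` (`comp_withDensity_eq`). In particular images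
of `σ` have densities, so the duality between the operator and the kernel is exact. Taking `u = ρ`
leaves `p_k` at the inverse update, which is `1 / ‖M_k⁻¹ φ‖²`. Strict subinvariance is the
harmonic–arithmetic mean inequality: with weights `|φ_i|²`, the harmonic mean of the `m_k(i)²` is
below their arithmetic mean `p_k(φ)`, and the `p_k` sum to `1`.

Sweeping does not go through `ρ`. For two distinct coordinates `V = |φ_i| |φ_j|` is an eigenfunction
of the kernel with eigenvalue `c = ∑ m_k(i) m_k(j)`, and `c < 1` by strict AM–GM. By duality `∫ |𝒫ⁿ
f| V ≤ cⁿ ∫ |f| V`, so mass leaves every set on which `V` is bounded below. -/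

namespace DualLyapunov

/-! ### Polar coordinates and linear changes of variables on the sphere. -/

section Polar

variable {E : Type*} [NormedAddCommGroup E] [NormedSpace ℝ E] [FiniteDimensional ℝ E]
  [MeasurableSpace E] [BorelSpace E]

/-- Integration in polar coordinates. -/
theorem lintegral_eq_lintegral_toSphere [Nontrivial E] (μ : Measure E) [μ.IsAddHaarMeasure]
    {F : E → ℝ≥0∞} (hF : Measurable F) :
    ∫⁻ x, F x ∂μ = ∫⁻ φ : Metric.sphere (0 : E) 1, ∫⁻ r in Set.Ioi (0 : ℝ),
      ENNReal.ofReal (r ^ (Module.finrank ℝ E - 1)) * F (r • (φ : E)) ∂volume ∂μ.toSphere := by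
  have hg : Measurable fun p : Metric.sphere (0 : E) 1 × Set.Ioi (0 : ℝ) =>
      F ((p.2 : ℝ) • (p.1 : E)) :=
    hF.comp ((measurable_subtype_coe.comp measurable_snd).smul
      (measurable_subtype_coe.comp measurable_fst))
  have key := μ.measurePreserving_homeomorphUnitSphereProd.lintegral_comp hg
  have e1 : ∀ x : ({0}ᶜ : Set E), F (((homeomorphUnitSphereProd E x).2 : ℝ) •
      ((homeomorphUnitSphereProd E x).1 : E)) = F x := by
    intro x
    have hx : ‖(x : E)‖ ≠ 0 := norm_ne_zero_iff.2 x.2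
    simp [homeomorphUnitSphereProd, smul_smul, hx]
  simp only [e1] at key
  rw [lintegral_subtype_comap (measurableSet_singleton (0 : E)).compl (fun x => F x),
    restrict_compl_singleton] at key
  rw [key, lintegral_prod _ hg.aemeasurable]
  refine lintegral_congr fun φ => ?_
  have hm : Measurable fun r : Set.Ioi (0 : ℝ) => F ((r : ℝ) • (φ : E)) :=
    hF.comp (measurable_subtype_coe.smul_const (φ : E))
  rw [Measure.volumeIoiPow, lintegral_withDensity_eq_lintegral_mul _ (by fun_prop) hm]
  exact lintegral_subtype_comap measurableSet_Ioi
    (fun r : ℝ => ENNReal.ofReal (r ^ (Module.finrank ℝ E - 1)) * F (r • (φ : E)))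

/-- The measure `dr / r` is invariant under dilations, so the scale `a` drops out. This is why the
shell integrals below do not depend on the gauge. -/
theorem lintegral_inv_mul_indicator_Ioo {a : ℝ} (ha : 0 < a) :
    ∫⁻ r in Set.Ioi (0 : ℝ), ENNReal.ofReal r⁻¹ * (Set.Ioo (1 : ℝ) 2).indicator 1 (r * a) =
      ENNReal.ofReal (Real.log 2) := by
  have hsub : Set.Ioo a⁻¹ (2 * a⁻¹) ⊆ Set.Ioi 0 := fun r hr => lt_trans (inv_pos.2 ha) hr.1
  have hab : a⁻¹ ≤ 2 * a⁻¹ := by linarith [inv_pos.2 ha]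
  have e : ∀ r : ℝ, ENNReal.ofReal r⁻¹ * (Set.Ioo (1 : ℝ) 2).indicator 1 (r * a) =
      (Set.Ioo a⁻¹ (2 * a⁻¹)).indicator (fun r => ENNReal.ofReal r⁻¹) r := by
    intro r
    have h : r * a ∈ Set.Ioo (1 : ℝ) 2 ↔ r ∈ Set.Ioo a⁻¹ (2 * a⁻¹) := by
      rw [Set.mem_Ioo, Set.mem_Ioo, ← div_eq_mul_inv 2 a, lt_div_iff₀ ha, inv_eq_one_div,
        div_lt_iff₀ ha]
    by_cases hr : r * a ∈ Set.Ioo (1 : ℝ) 2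
    · rw [Set.indicator_of_mem hr, Set.indicator_of_mem (h.1 hr)]
      simp
    · rw [Set.indicator_of_notMem hr, Set.indicator_of_notMem (fun h' => hr (h.2 h')), mul_zero]
  have hne : (0 : ℝ) ∉ Set.uIcc a⁻¹ (2 * a⁻¹) := by
    rw [Set.uIcc_of_le hab]
    exact fun h => absurd h.1 (not_le.2 (inv_pos.2 ha))
  simp_rw [e]
  rw [lintegral_indicator measurableSet_Ioo, Measure.restrict_restrict measurableSet_Ioo,
    Set.inter_eq_left.2 hsub, restrict_Ioo_eq_restrict_Ioc, ← ofReal_integral_eq_lintegral_ofReal,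
    ← intervalIntegral.integral_of_le hab, integral_inv hne]
  · rw [mul_div_cancel_right₀ _ (inv_pos.2 ha).ne']
  · exact (intervalIntegral.intervalIntegrable_inv (fun x hx h => hne (h ▸ hx))
      continuousOn_id).1
  · filter_upwards [ae_restrict_mem measurableSet_Ioc] with r hr
    exact (inv_pos.2 ((inv_pos.2 ha).trans hr.1)).le

/-- The integral over a shell of a function which is homogeneous of degree minus the dimension,
where the shell is taken with respect to a positively homogeneous gauge. -/
theorem lintegral_mul_indicator_Ioo [Nontrivial E] (μ : Measure E) [μ.IsAddHaarMeasure]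
    {w : E → ℝ≥0∞} (hw : Measurable w)
    (hom : ∀ r : ℝ, 0 < r → ∀ x, ENNReal.ofReal (r ^ Module.finrank ℝ E) * w (r • x) = w x)
    {n : E → ℝ} (hn : Measurable n) (hn1 : ∀ r : ℝ, 0 < r → ∀ x, n (r • x) = r * n x)
    (hn0 : ∀ x, x ≠ 0 → 0 < n x) :
    ∫⁻ x, w x * (Set.Ioo (1 : ℝ) 2).indicator 1 (n x) ∂μ =
      ENNReal.ofReal (Real.log 2) * ∫⁻ φ, w φ ∂μ.toSphere := by
  have hI : Measurable ((Set.Ioo (1 : ℝ) 2).indicator (1 : ℝ → ℝ≥0∞)) :=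
    measurable_one.indicator measurableSet_Ioo
  rw [lintegral_eq_lintegral_toSphere μ
      (F := fun x => w x * (Set.Ioo (1 : ℝ) 2).indicator 1 (n x)) (hw.mul (hI.comp hn)),
    ← lintegral_const_mul (f := fun φ : Metric.sphere (0 : E) 1 => w φ) _
      (hw.comp measurable_subtype_coe)]
  refine lintegral_congr fun φ => ?_
  rw [← lintegral_inv_mul_indicator_Ioo (hn0 φ (ne_zero_of_mem_unit_sphere φ)),
    ← lintegral_mul_const _ (by fun_prop)]
  refine setLIntegral_congr_fun measurableSet_Ioi fun r hr => ?_
  have hr0 : (0 : ℝ) < r := hr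
  change ENNReal.ofReal (r ^ (Module.finrank ℝ E - 1)) * (w (r • (φ : E)) *
    (Set.Ioo (1 : ℝ) 2).indicator 1 (n (r • (φ : E)))) = _
  -- Homogeneity of `w` absorbs `r ^ d`, leaving the radial measure `dr / r`.
  have hd : r ^ (Module.finrank ℝ E - 1) = r⁻¹ * r ^ Module.finrank ℝ E := by
    have hpos : 0 < Module.finrank ℝ E := Module.finrank_pos
    conv_rhs => rw [← Nat.sub_add_cancel hpos, pow_succ]
    field_simp
  rw [hn1 r hr0, ← hom r hr0 φ, hd, ENNReal.ofReal_mul (inv_pos.2 hr0).le]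
  ring

/-- Change of variables on the sphere for a linear map, acting on functions which are homogeneous
of degree minus the dimension. -/
theorem lintegral_toSphere_comp_linear [Nontrivial E] (μ : Measure E) [μ.IsAddHaarMeasure]
    {w : E → ℝ≥0∞} (hw : Measurable w)
    (hom : ∀ r : ℝ, 0 < r → ∀ x, ENNReal.ofReal (r ^ Module.finrank ℝ E) * w (r • x) = w x)
    (L : E →ₗ[ℝ] E) (hL : LinearMap.det L ≠ 0) :
    ∫⁻ φ : Metric.sphere (0 : E) 1, w (L φ) ∂μ.toSphere =
      ENNReal.ofReal |(LinearMap.det L)⁻¹| * ∫⁻ φ, w φ ∂μ.toSphere := by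
  have hLm : Measurable L := L.continuous_of_finiteDimensional.measurable
  have hI : Measurable ((Set.Ioo (1 : ℝ) 2).indicator (1 : ℝ → ℝ≥0∞)) :=
    measurable_one.indicator measurableSet_Ioo
  have hinj : ∀ x, x ≠ 0 → L x ≠ 0 := fun x hx h =>
    hx ((LinearMap.equivOfDetNeZero L hL).injective (by simpa using h))
  -- The gauge `‖L x‖` makes this shell the preimage under `L` of the round shell in `h2`, so the
  -- linear change of variables in `h3` compares the two spherical integrals directly.
  have h1 := lintegral_mul_indicator_Ioo μ (w := fun x => w (L x)) (hw.comp hLm)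
    (fun r hr x => by rw [map_smul]; exact hom r hr _) (n := fun x => ‖L x‖) hLm.norm
    (fun r hr x => by rw [map_smul, norm_smul, Real.norm_of_nonneg hr.le])
    (fun x hx => norm_pos_iff.2 (hinj x hx))
  have h2 := lintegral_mul_indicator_Ioo μ hw hom (n := fun x => ‖x‖) measurable_norm
    (fun r hr x => by rw [norm_smul, Real.norm_of_nonneg hr.le])
    (fun x hx => norm_pos_iff.2 hx)
  have h3 := lintegral_map (μ := μ) (hw.mul (hI.comp measurable_norm)) hLm
  rw [Measure.map_linearMap_addHaar_eq_smul_addHaar μ hL, lintegral_smul_measure] at h3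
  change _ * ∫⁻ x, w x * (Set.Ioo (1 : ℝ) 2).indicator 1 ‖x‖ ∂μ =
    ∫⁻ x, w (L x) * (Set.Ioo (1 : ℝ) 2).indicator 1 ‖L x‖ ∂μ at h3
  rw [h1, h2] at h3
  have hc : ENNReal.ofReal (Real.log 2) ≠ 0 := by
    simpa using Real.log_pos one_lt_two
  rw [mul_left_comm] at h3
  exact ((ENNReal.mul_right_inj hc ENNReal.ofReal_ne_top).1 h3).symm

end Polar

/-! ### The weight `ρ` and its invariance under diagonal maps. -/

section Diagonal

variable {N : ℕ}

/-- The real determinant of a complex linear map is the norm from `ℂ` to `ℝ` of its complex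
determinant. -/
theorem det_toEuclideanCLM_restrictScalars (M : Matrix (Fin N) (Fin N) ℂ) :
    LinearMap.det (((Matrix.toEuclideanCLM (𝕜 := ℂ) M).toLinearMap).restrictScalars ℝ) =
      Complex.normSq M.det := by
  rw [LinearMap.det_restrictScalars, Algebra.norm_complex_apply,
    Matrix.coe_toEuclideanCLM_eq_toEuclideanLin, Matrix.toEuclideanLin_eq_toLin_orthonormal,
    LinearMap.det_toLin]

theorem mulVecE_diagonal_apply (c : Fin N → ℂ) (x : EuclideanSpace ℂ (Fin N)) (i : Fin N) :
    mulVecE (Matrix.diagonal c) x i = c i * x i := by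
  rw [mulVecE, Matrix.ofLp_toEuclideanCLM, Matrix.mulVec_diagonal]

/-- The extension of `inverseProduct` to the whole space. -/
noncomputable def invProd (x : EuclideanSpace ℂ (Fin N)) : ℝ≥0∞ :=
  (∏ i, ENNReal.ofReal (‖x i‖ ^ 2))⁻¹

theorem measurable_invProd : Measurable (invProd (N := N)) := by
  unfold invProd
  fun_prop

theorem measurable_inverseProduct : Measurable (inverseProduct (N := N)) :=
  measurable_invProd.comp measurable_subtype_coe

/-- Serves both for real dilations (constant `a`), giving homogeneity, and for `M_k` (`a = m k`),
where the factor is the Jacobian. -/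
theorem invProd_of_mul {a : Fin N → ℝ} (ha : ∀ i, a i ≠ 0) {x y : EuclideanSpace ℂ (Fin N)}
    (hy : ∀ i, ‖y i‖ = |a i| * ‖x i‖) :
    ENNReal.ofReal (∏ i, a i ^ 2) * invProd y = invProd x := by
  have h1 : ∏ i, ENNReal.ofReal (‖y i‖ ^ 2) =
      ENNReal.ofReal (∏ i, a i ^ 2) * ∏ i, ENNReal.ofReal (‖x i‖ ^ 2) := by
    rw [ENNReal.ofReal_prod_of_nonneg fun i _ => sq_nonneg _, ← Finset.prod_mul_distrib]
    refine Finset.prod_congr rfl fun i _ => ?_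
    rw [hy, mul_pow, sq_abs, ENNReal.ofReal_mul (sq_nonneg _)]
  have hpos : 0 < ∏ i, a i ^ 2 := Finset.prod_pos fun i _ => by have := ha i; positivity
  have h0 : ENNReal.ofReal (∏ i, a i ^ 2) ≠ 0 := by simpa using hpos
  rw [invProd, h1, ENNReal.mul_inv (Or.inl h0) (Or.inl ENNReal.ofReal_ne_top), ← mul_assoc,
    ENNReal.mul_inv_cancel h0 ENNReal.ofReal_ne_top, one_mul, invProd]

theorem invProd_smul {r : ℝ} (hr : 0 < r) (x : EuclideanSpace ℂ (Fin N)) :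
    ENNReal.ofReal (r ^ Module.finrank ℝ (EuclideanSpace ℂ (Fin N))) * invProd (r • x) =
      invProd x := by
  rw [← invProd_of_mul (a := fun _ => r) (fun _ => hr.ne') (y := r • x) (x := x)]
  · simp [finrank_real_of_complex, pow_mul]
  · intro i
    simp

theorem inverseProduct_ne_zero (φ : StateSphere N) : inverseProduct φ ≠ 0 :=
  ENNReal.inv_ne_zero.2 (ENNReal.prod_ne_top fun _ _ => ENNReal.ofReal_ne_top)

theorem inverseProduct_ne_top_iff (φ : StateSphere N) :
    inverseProduct φ ≠ ∞ ↔ ∀ i, (φ : EuclideanSpace ℂ (Fin N)) i ≠ 0 := by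
  rw [inverseProduct, Ne, ENNReal.inv_eq_top, Finset.prod_eq_zero_iff]
  simp

/-- The cone over the points with vanishing `i`-th coordinate lies in a proper real subspace, which
is Lebesgue null. -/
theorem ae_apply_ne_zero : ∀ᵐ φ : StateSphere N ∂stateMeasure N,
    ∀ i, (φ : EuclideanSpace ℂ (Fin N)) i ≠ 0 := by
  rw [ae_all_iff]
  intro i
  have hm : MeasurableSet {φ : StateSphere N | (φ : EuclideanSpace ℂ (Fin N)) i = 0} :=
    measurableSet_eq_fun (by fun_prop) measurable_const
  rw [ae_iff]
  simp only [not_not]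
  rw [Measure.toSphere_apply' _ hm]
  refine mul_eq_zero_of_right _ ?_
  let p : Submodule ℝ (EuclideanSpace ℂ (Fin N)) :=
    { carrier := {x | x i = 0}
      add_mem' := fun {x y} hx hy => by
        have hx' : x i = 0 := hx
        have hy' : y i = 0 := hy
        simp [hx', hy']
      zero_mem' := by simp
      smul_mem' := fun c x hx => by
        have hx' : x i = 0 := hx
        simp [hx'] }
  have hp : p ≠ ⊤ := by
    intro h
    have h1 : EuclideanSpace.single i (1 : ℂ) ∈ p := h ▸ Submodule.mem_top
    have h2 : (EuclideanSpace.single i (1 : ℂ)) i = 0 := h1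
    simp at h2
  refine measure_mono_null ?_ (Measure.addHaar_submodule volume p hp)
  rintro _ ⟨r, -, _, ⟨φ, hφ, rfl⟩, rfl⟩
  exact p.smul_mem r hφ

theorem ae_inverseProduct_ne_top : ∀ᵐ φ ∂stateMeasure N, inverseProduct φ ≠ ∞ := by
  filter_upwards [ae_apply_ne_zero] with φ hφ using (inverseProduct_ne_top_iff φ).2 hφ

namespace QNDSystem

variable {K : ℕ} (m : Fin K → Fin N → ℝ) (hm : ∀ k i, m k i ∈ Set.Ioo (0 : ℝ) 1)
  (hsum : ∀ i, ∑ k, m k i ^ 2 = 1)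

theorem mulVecE_diagonal_M (k : Fin K) (x : EuclideanSpace ℂ (Fin N)) (i : Fin N) :
    mulVecE ((diagonal m hm hsum).M k) x i = m k i * x i :=
  mulVecE_diagonal_apply _ x i

/-- The measure with density `inverseProduct` is invariant under every update map. -/
theorem lintegral_inverseProduct_mul_comp_update (k : Fin K)
    {g : StateSphere N → ℝ≥0∞} (hg : Measurable g) :
    ∫⁻ φ, inverseProduct φ * g ((diagonal m hm hsum).update k φ) ∂stateMeasure N =
      ∫⁻ φ, inverseProduct φ * g φ ∂stateMeasure N := by
  rcases Nat.eq_zero_or_pos N with rfl | hN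
  · have : IsEmpty (StateSphere 0) := ⟨fun φ => ne_zero_of_mem_unit_sphere φ (Subsingleton.elim _ _)⟩
    simp
  have : Nonempty (Fin N) := ⟨⟨0, hN⟩⟩
  obtain ⟨G, hG, hGg⟩ := (MeasurableEmbedding.subtype_coe
    (Metric.isClosed_sphere (x := (0 : EuclideanSpace ℂ (Fin N))) (ε := 1)).measurableSet).exists_measurable_extend hg fun _ => ⟨0⟩
  have hGg' : ∀ φ : StateSphere N, G φ = g φ := fun φ => congrFun hGg φ
  -- Extending `g` with degree `0` gives `w` the degree required for the change of variables;
  -- evaluating `w` at `M φ` produces the normalisation of the update map.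
  let w : EuclideanSpace ℂ (Fin N) → ℝ≥0∞ := fun x => invProd x * G (‖x‖⁻¹ • x)
  have hw : Measurable w :=
    measurable_invProd.mul (hG.comp (measurable_norm.inv.smul measurable_id))
  have hom : ∀ r : ℝ, 0 < r → ∀ x, ENNReal.ofReal
      (r ^ Module.finrank ℝ (EuclideanSpace ℂ (Fin N))) * w (r • x) = w x := by
    intro r hr x
    have e : ‖r • x‖⁻¹ • r • x = ‖x‖⁻¹ • x := by
      rw [norm_smul, Real.norm_of_nonneg hr.le, smul_smul, mul_inv, mul_right_comm,
        inv_mul_cancel₀ hr.ne', one_mul]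
    simp only [w]
    rw [← mul_assoc, invProd_smul hr, e]
  set M := (diagonal m hm hsum).M k with hM
  have hprod : 0 < ∏ i, m k i ^ 2 := Finset.prod_pos fun i _ => by have := (hm k i).1; positivity
  have hdet : LinearMap.det (((Matrix.toEuclideanCLM (𝕜 := ℂ) M).toLinearMap).restrictScalars ℝ) =
      ∏ i, m k i ^ 2 := by
    rw [det_toEuclideanCLM_restrictScalars, hM]
    change Complex.normSq (Matrix.diagonal _).det = _
    rw [Matrix.det_diagonal, map_prod]
    simp [Complex.normSq_ofReal, sq]
  have key := lintegral_toSphere_comp_linear volume hw hom _ (by rw [hdet]; exact hprod.ne')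
  rw [hdet, abs_of_pos (inv_pos.2 hprod), ENNReal.ofReal_inv_of_pos hprod] at key
  have h0 : ENNReal.ofReal (∏ i, m k i ^ 2) ≠ 0 := by simpa using hprod
  have e1 : ∀ φ : StateSphere N, w φ = inverseProduct φ * g φ := by
    intro φ
    simp only [w]
    rw [norm_eq_of_mem_sphere, inv_one, one_smul, hGg']
    rfl
  have e2 : ∀ φ : StateSphere N, inverseProduct φ * g ((diagonal m hm hsum).update k φ) =
      ENNReal.ofReal (∏ i, m k i ^ 2) * w (mulVecE M φ) := by
    intro φ
    simp only [w]
    rw [← mul_assoc, invProd_of_mul (x := φ) (fun i => (hm k i).1.ne'), ← hGg']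
    · change inverseProduct φ * G (((‖mulVecE M φ‖⁻¹ : ℝ) : ℂ) • mulVecE M φ) = _
      rw [Complex.coe_smul]
      rfl
    · intro i
      rw [mulVecE_diagonal_M, norm_mul, Complex.norm_real, Real.norm_eq_abs]
  simp_rw [e2]
  have hwm : Measurable fun φ : StateSphere N => w (mulVecE M φ) := hw.comp (by fun_prop)
  rw [lintegral_const_mul _ hwm]
  change _ * ∫⁻ φ : StateSphere N,
    w (((Matrix.toEuclideanCLM (𝕜 := ℂ) M).toLinearMap.restrictScalars ℝ) φ) ∂stateMeasure N = _
  rw [key, ← mul_assoc, ENNReal.mul_inv_cancel h0 ENNReal.ofReal_ne_top, one_mul]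
  exact lintegral_congr e1

end QNDSystem

end Diagonal

/-! ### Duality and mass decay for kernels that preserve null sets. -/

section NonsingularKernel

variable {X : Type*} [MeasurableSpace X] {σ : Measure X} [SigmaFinite σ] {κ : Kernel X X}
  [IsMarkovKernel κ]

theorem coeFn_frobeniusPerron (f : Lp ℝ 1 σ) :
    (frobeniusPerron σ κ).toCLM f =ᵐ[σ] perronFun σ κ f :=
  Integrable.coeFn_toL1 (integrable_perronFun (κ := κ) (L1.integrable_coeFn f))

/-- Absolute continuity leaves the image measure without a singular part, so its Radon–Nikodym
derivative recovers all of it and duality is an equality. -/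
theorem lintegral_perronDensity_mul (hκ : κ ∘ₘ σ ≪ σ) {u g : X → ℝ≥0∞} (hu : AEMeasurable u σ)
    (hg : Measurable g) :
    ∫⁻ x, perronDensity σ κ u x * g x ∂σ = ∫⁻ x, u x * ∫⁻ y, g y ∂κ x ∂σ := by
  have hac : κ ∘ₘ σ.withDensity u ≪ σ :=
    ((withDensity_absolutelyContinuous σ u).comp_right κ).trans hκ
  have h1 : σ.withDensity (perronDensity σ κ u) = κ ∘ₘ σ.withDensity u :=
    Measure.withDensity_rnDeriv_eq _ _ hac
  have h2 := congrArg (fun μ => ∫⁻ x, g x ∂μ) h1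
  rw [lintegral_withDensity_eq_lintegral_mul σ (by exact Measure.measurable_rnDeriv _ _) hg,
    Measure.lintegral_bind κ.aemeasurable hg.aemeasurable,
    lintegral_withDensity_eq_lintegral_mul₀ hu hg.lintegral_kernel.aemeasurable] at h2
  exact h2

theorem setIntegral_frobeniusPerron (hκ : κ ∘ₘ σ ≪ σ) (f : Lp ℝ 1 σ) {A : Set X}
    (hA : MeasurableSet A) :
    ∫ x in A, (frobeniusPerron σ κ).toCLM f x ∂σ = ∫ x, f x * (κ x).real A ∂σ := by
  have hf := L1.integrable_coeFn f
  have hmeas : Measurable fun x => (κ x).real A := (κ.measurable_coe hA).ennreal_toReal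
  have key : ∀ h : X → ℝ, Integrable h σ →
      IntegrableOn (fun x => (perronDensity σ κ (fun y => ENNReal.ofReal (h y)) x).toReal) A σ ∧
      ∫ x in A, (perronDensity σ κ (fun y => ENNReal.ofReal (h y)) x).toReal ∂σ =
        ∫ x, max (h x) 0 * (κ x).real A ∂σ := by
    intro h hh
    have hm : Measurable (perronDensity σ κ fun y => ENNReal.ofReal (h y)) :=
      Measure.measurable_rnDeriv _ _
    refine ⟨(integrable_toReal_of_lintegral_ne_top hm.aemeasurable (ne_top_of_le_ne_top
      (lintegral_ofReal_ne_top hh) (lintegral_perronDensity_le _))).integrableOn, ?_⟩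
    rw [integral_toReal hm.aemeasurable
      (ae_restrict_of_ae (perronDensity_lt_top (lintegral_ofReal_ne_top hh))),
      integral_eq_lintegral_of_nonneg_ae
        (Eventually.of_forall fun x => mul_nonneg (le_max_right _ _) measureReal_nonneg)
        ((hh.1.aemeasurable.max aemeasurable_const).mul hmeas.aemeasurable).aestronglyMeasurable]
    congr 1
    have h3 := lintegral_perronDensity_mul hκ hh.1.aemeasurable.ennreal_ofReal
      (measurable_one.indicator hA)
    have e1 : ∀ x, perronDensity σ κ (fun y => ENNReal.ofReal (h y)) x * A.indicator 1 x =
        A.indicator (perronDensity σ κ fun y => ENNReal.ofReal (h y)) x := fun x => by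
      by_cases hx : x ∈ A <;> simp [hx]
    simp_rw [e1] at h3
    rw [lintegral_indicator hA] at h3
    rw [h3]
    refine lintegral_congr fun x => ?_
    rw [lintegral_indicator_one hA, ENNReal.ofReal_mul (le_max_right _ _), ofReal_measureReal]
    congr 1
    rcases le_total (h x) 0 with h0 | h0
    · simp [h0]
    · simp [h0]
  obtain ⟨i1, k1⟩ := key f hf
  obtain ⟨i2, k2⟩ := key (fun x => -f x) hf.neg
  have hbd : ∀ h : X → ℝ, Integrable h σ →
      Integrable (fun x => max (h x) 0 * (κ x).real A) σ := by
    intro h hh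
    refine Integrable.mono' hh.norm
      ((hh.1.aemeasurable.max aemeasurable_const).mul hmeas.aemeasurable).aestronglyMeasurable
      (Eventually.of_forall fun x => ?_)
    rw [norm_mul, Real.norm_of_nonneg (le_max_right _ _), Real.norm_of_nonneg measureReal_nonneg]
    calc max (h x) 0 * (κ x).real A ≤ max (h x) 0 * 1 :=
          mul_le_mul_of_nonneg_left measureReal_le_one (le_max_right _ _)
      _ ≤ ‖h x‖ := by rw [mul_one]; exact max_le (le_abs_self _) (norm_nonneg _)
  rw [setIntegral_congr_ae hA ((coeFn_frobeniusPerron f).mono fun x hx _ => hx)]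
  change ∫ x in A, ((perronDensity σ κ (fun y => ENNReal.ofReal (f y)) x).toReal -
    (perronDensity σ κ (fun y => ENNReal.ofReal (-f y)) x).toReal) ∂σ = _
  rw [integral_sub i1 i2, k1, k2, ← integral_sub (hbd _ hf) (hbd (fun x => -f x) hf.neg)]
  refine integral_congr_ae (Eventually.of_forall fun x => ?_)
  change max (f x) 0 * _ - max (-f x) 0 * _ = _
  rw [← sub_mul]
  congr 1
  rcases le_total (f x) 0 with h0 | h0
  · simp [h0]
  · simp [h0]

/-- The image of `f` is dominated in modulus by the sum of the images of its positive and negative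
parts; duality is applied to each. -/
theorem lintegral_enorm_frobeniusPerron_mul_le (hκ : κ ∘ₘ σ ≪ σ) (f : Lp ℝ 1 σ) {V : X → ℝ≥0∞}
    (hV : Measurable V) :
    ∫⁻ x, ‖(frobeniusPerron σ κ).toCLM f x‖ₑ * V x ∂σ ≤ ∫⁻ x, ‖f x‖ₑ * ∫⁻ y, V y ∂κ x ∂σ := by
  have hf := (L1.integrable_coeFn f).1.aemeasurable
  have h1 : ∀ᵐ x ∂σ, ‖(frobeniusPerron σ κ).toCLM f x‖ₑ * V x ≤
      perronDensity σ κ (fun y => ENNReal.ofReal (f y)) x * V x +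
        perronDensity σ κ (fun y => ENNReal.ofReal (-f y)) x * V x := by
    filter_upwards [coeFn_frobeniusPerron (κ := κ) f] with x hx
    rw [hx, ← add_mul]
    refine mul_le_mul_left ((enorm_sub_le).trans (add_le_add ?_ ?_)) _ <;>
    · rw [Real.enorm_of_nonneg ENNReal.toReal_nonneg]
      exact ENNReal.ofReal_toReal_le
  have hm : ∀ u : X → ℝ≥0∞, Measurable fun x => perronDensity σ κ u x * V x :=
    fun u => Measurable.mul (Measure.measurable_rnDeriv _ _) hV
  refine (lintegral_mono_ae h1).trans ?_
  rw [lintegral_add_left (hm _),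
    lintegral_perronDensity_mul hκ hf.ennreal_ofReal hV,
    lintegral_perronDensity_mul (u := fun x => ENNReal.ofReal (-f x)) hκ hf.neg.ennreal_ofReal hV,
    ← lintegral_add_left' (f := fun x => ENNReal.ofReal (f x) * ∫⁻ y, V y ∂κ x)
      (hf.ennreal_ofReal.mul hV.lintegral_kernel.aemeasurable)]
  refine lintegral_mono fun x => ?_
  rw [← add_mul]
  refine mul_le_mul_left (le_of_eq ?_) _
  rcases le_total (f x) 0 with h | h
  · simp [ENNReal.ofReal_of_nonpos h, Real.enorm_eq_ofReal_abs, abs_of_nonpos h]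
  · simp [ENNReal.ofReal_of_nonpos (neg_nonpos.2 h), Real.enorm_eq_ofReal_abs, abs_of_nonneg h]

theorem lintegral_enorm_frobeniusPerron_pow_mul_le (hκ : κ ∘ₘ σ ≪ σ) {V : X → ℝ≥0∞}
    (hV : Measurable V) {c : ℝ≥0∞} (hc0 : c ≠ ∞) (hc : ∀ x, ∫⁻ y, V y ∂κ x ≤ c * V x) (n : ℕ) (f : Lp ℝ 1 σ) :
    ∫⁻ x, ‖((frobeniusPerron σ κ).toCLM ^ n) f x‖ₑ * V x ∂σ ≤ c ^ n * ∫⁻ x, ‖f x‖ₑ * V x ∂σ := by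
  induction n with
  | zero => simp
  | succ n ih =>
    rw [pow_succ' (frobeniusPerron σ κ).toCLM]
    refine (lintegral_enorm_frobeniusPerron_mul_le hκ _ hV).trans ?_
    refine (lintegral_mono fun x => mul_le_mul_right (hc x) _).trans ?_
    simp_rw [mul_left_comm _ c]
    rw [lintegral_const_mul' _ _ hc0, pow_succ', mul_assoc]
    exact mul_le_mul_right ih _

/-- A bounded function which the kernel contracts by a factor less than `1` forces the mass to leave
every set on which that function is bounded from below. -/
theorem tendsto_setIntegral_frobeniusPerron_pow (hκ : κ ∘ₘ σ ≪ σ) {V : X → ℝ≥0∞}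
    (hV : Measurable V) (hV1 : ∀ x, V x ≤ 1) {c : ℝ≥0∞} (hc1 : c < 1)
    (hc : ∀ x, ∫⁻ y, V y ∂κ x ≤ c * V x) {A : Set X} (hA : MeasurableSet A) {δ : ℝ≥0∞}
    (hδ : δ ≠ 0) (hδ1 : δ ≠ ∞) (hVA : ∀ x ∈ A, δ ≤ V x) (f : Lp ℝ 1 σ) :
    Tendsto (fun n : ℕ => ∫ x in A, ((frobeniusPerron σ κ).toCLM ^ n) f x ∂σ) atTop (𝓝 0) := by
  have hfin : ∫⁻ x, ‖f x‖ₑ * V x ∂σ ≠ ∞ := by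
    refine ne_top_of_le_ne_top (L1.integrable_coeFn f).2.ne (lintegral_mono fun x => ?_)
    exact mul_le_of_le_one_right' (hV1 x)
  have hle : ∀ n : ℕ, ‖∫ x in A, ((frobeniusPerron σ κ).toCLM ^ n) f x ∂σ‖ₑ ≤
      δ⁻¹ * (c ^ n * ∫⁻ x, ‖f x‖ₑ * V x ∂σ) := by
    intro n
    refine (enorm_integral_le_lintegral_enorm _).trans ?_
    refine le_trans ?_ (mul_le_mul_right
      (lintegral_enorm_frobeniusPerron_pow_mul_le hκ hV (hc1.trans_le le_top).ne hc n f) _)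
    rw [← lintegral_const_mul' _ _ (ENNReal.inv_ne_top.2 hδ)]
    refine le_trans (setLIntegral_mono' hA fun x hx => ?_) (setLIntegral_le_lintegral A _)
    -- Chebyshev's argument: `1 ≤ δ⁻¹ * V` on `A`.
    calc ‖((frobeniusPerron σ κ).toCLM ^ n) f x‖ₑ
        = δ⁻¹ * (‖((frobeniusPerron σ κ).toCLM ^ n) f x‖ₑ * δ) := by
          rw [mul_left_comm, ENNReal.inv_mul_cancel hδ hδ1, mul_one]
      _ ≤ _ := mul_le_mul_right (mul_le_mul_right (hVA x hx) _) _
  rw [tendsto_iff_enorm_sub_tendsto_zero]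
  simp only [sub_zero]
  refine tendsto_of_tendsto_of_tendsto_of_le_of_le tendsto_const_nhds ?_ (fun _ => zero_le) hle
  have h1 := ENNReal.Tendsto.mul_const (ENNReal.tendsto_pow_atTop_nhds_zero_of_lt_one hc1)
    (Or.inr hfin)
  have h2 := ENNReal.Tendsto.const_mul h1 (Or.inr (ENNReal.inv_ne_top.2 hδ))
  simpa using h2

end NonsingularKernel

/-! ### Inverse updates and the explicit density of the image measure. -/

namespace QNDSystem

section General

variable {N K : ℕ} (S : QNDSystem N K)

theorem mulVecE_inv_mulVecE (k : Fin K) (x : EuclideanSpace ℂ (Fin N)) :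
    mulVecE (S.M k)⁻¹ (mulVecE (S.M k) x) = x := by
  change (Matrix.toEuclideanCLM (𝕜 := ℂ) (S.M k)⁻¹ * Matrix.toEuclideanCLM (𝕜 := ℂ) (S.M k)) x = x
  rw [← map_mul, Matrix.nonsing_inv_mul _ ((Matrix.isUnit_iff_isUnit_det _).1 (S.posDef k).isUnit)]
  simp

theorem mulVecE_mulVecE_inv (k : Fin K) (x : EuclideanSpace ℂ (Fin N)) :
    mulVecE (S.M k) (mulVecE (S.M k)⁻¹ x) = x := by
  change (Matrix.toEuclideanCLM (𝕜 := ℂ) (S.M k) * Matrix.toEuclideanCLM (𝕜 := ℂ) (S.M k)⁻¹) x = x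
  rw [← map_mul, Matrix.mul_nonsing_inv _ ((Matrix.isUnit_iff_isUnit_det _).1 (S.posDef k).isUnit)]
  simp

theorem norm_mulVecE_inv_ne_zero (k : Fin K) (φ : StateSphere N) :
    ‖mulVecE (S.M k)⁻¹ (φ : EuclideanSpace ℂ (Fin N))‖ ≠ 0 := by
  rw [norm_ne_zero_iff]
  intro h
  have h1 := S.mulVecE_mulVecE_inv k φ
  rw [h] at h1
  exact ne_zero_of_mem_unit_sphere φ (h1.symm.trans (map_zero (Matrix.toEuclideanCLM (𝕜 := ℂ) (S.M k))))

/-- The inverse `φ ↦ M_k⁻¹ φ / ‖M_k⁻¹ φ‖` of `update`. -/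
noncomputable def invUpdate (k : Fin K) (φ : StateSphere N) : StateSphere N :=
  ⟨((‖mulVecE (S.M k)⁻¹ φ‖⁻¹ : ℝ) : ℂ) • mulVecE (S.M k)⁻¹ φ, by
    rw [mem_sphere_zero_iff_norm, norm_smul, Complex.norm_real, norm_inv, norm_norm,
      inv_mul_cancel₀ (S.norm_mulVecE_inv_ne_zero k φ)]⟩

theorem continuous_invUpdate (k : Fin K) : Continuous (S.invUpdate k) := by
  have h : Continuous fun φ : StateSphere N => mulVecE (S.M k)⁻¹ φ := by fun_prop
  refine Continuous.subtype_mk ?_ _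
  exact (Complex.continuous_ofReal.comp
    (h.norm.inv₀ fun φ => S.norm_mulVecE_inv_ne_zero k φ)).smul h

theorem invUpdate_update (k : Fin K) (φ : StateSphere N) : S.invUpdate k (S.update k φ) = φ := by
  have h0 : ‖mulVecE (S.M k) φ‖ ≠ 0 := norm_ne_zero_iff.2 (S.mulVecE_ne_zero k φ)
  have h : mulVecE (S.M k)⁻¹ (S.update k φ) =
      ((‖mulVecE (S.M k) φ‖⁻¹ : ℝ) : ℂ) • (φ : EuclideanSpace ℂ (Fin N)) := by
    change mulVecE (S.M k)⁻¹ (((‖mulVecE (S.M k) φ‖⁻¹ : ℝ) : ℂ) • mulVecE (S.M k) φ) = _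
    rw [mulVecE, map_smul]
    exact congrArg _ (S.mulVecE_inv_mulVecE k φ)
  refine Subtype.ext ?_
  rw [invUpdate]
  change ((‖mulVecE (S.M k)⁻¹ (S.update k φ)‖⁻¹ : ℝ) : ℂ) • mulVecE (S.M k)⁻¹ (S.update k φ) = _
  rw [h, norm_smul, norm_eq_of_mem_sphere, mul_one, Complex.norm_real, norm_inv, norm_norm,
    inv_inv, smul_smul, ← Complex.ofReal_mul, mul_inv_cancel₀ h0, Complex.ofReal_one, one_smul]

theorem prob_invUpdate (k : Fin K) (φ : StateSphere N) :
    S.prob k (S.invUpdate k φ) = 1 / ‖mulVecE (S.M k)⁻¹ φ‖ ^ 2 := by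
  have h : mulVecE (S.M k) (S.invUpdate k φ) =
      ((‖mulVecE (S.M k)⁻¹ φ‖⁻¹ : ℝ) : ℂ) • (φ : EuclideanSpace ℂ (Fin N)) := by
    change mulVecE (S.M k) (((‖mulVecE (S.M k)⁻¹ φ‖⁻¹ : ℝ) : ℂ) • mulVecE (S.M k)⁻¹ φ) = _
    rw [mulVecE, map_smul]
    exact congrArg _ (S.mulVecE_mulVecE_inv k φ)
  rw [prob, h, norm_smul, norm_eq_of_mem_sphere, Complex.norm_real, norm_inv, norm_norm, mul_one, inv_pow, one_div]

theorem lintegral_transition (φ : StateSphere N) {g : StateSphere N → ℝ≥0∞} (hg : Measurable g) :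
    ∫⁻ ψ, g ψ ∂S.transition φ = ∑ k, ENNReal.ofReal (S.prob k φ) * g (S.update k φ) := by
  change ∫⁻ ψ, g ψ ∂(∑ k, ENNReal.ofReal (S.prob k φ) • Measure.dirac (S.update k φ)) = _
  rw [lintegral_finsetSum_measure]
  refine Finset.sum_congr rfl fun k _ => ?_
  rw [lintegral_smul_measure, lintegral_dirac' _ hg, smul_eq_mul]

end General

section Diagonal

variable {N K : ℕ} (m : Fin K → Fin N → ℝ) (hm : ∀ k i, m k i ∈ Set.Ioo (0 : ℝ) 1)
  (hsum : ∀ i, ∑ k, m k i ^ 2 = 1)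

theorem norm_update_apply (k : Fin K) (φ : StateSphere N) (i : Fin N) :
    ‖((diagonal m hm hsum).update k φ : EuclideanSpace ℂ (Fin N)) i‖ =
      ‖mulVecE ((diagonal m hm hsum).M k) φ‖⁻¹ *
        (m k i * ‖(φ : EuclideanSpace ℂ (Fin N)) i‖) := by
  rw [update]
  change ‖((_ : ℝ) : ℂ) * mulVecE ((diagonal m hm hsum).M k) φ i‖ = _
  rw [mulVecE_diagonal_M, norm_mul, norm_mul, Complex.norm_real, Complex.norm_real, norm_inv,
    norm_norm, Real.norm_of_nonneg (hm k i).1.le]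

theorem invUpdate_apply_ne_zero (k : Fin K) {φ : StateSphere N}
    (hφ : ∀ i, (φ : EuclideanSpace ℂ (Fin N)) i ≠ 0) (i : Fin N) :
    ((diagonal m hm hsum).invUpdate k φ : EuclideanSpace ℂ (Fin N)) i ≠ 0 := by
  have h : (φ : EuclideanSpace ℂ (Fin N)) i =
      m k i * mulVecE ((diagonal m hm hsum).M k)⁻¹ φ i := by
    rw [← mulVecE_diagonal_M m hm hsum, mulVecE_mulVecE_inv]
  rw [invUpdate]
  change ((_ : ℝ) : ℂ) * mulVecE ((diagonal m hm hsum).M k)⁻¹ φ i ≠ 0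
  refine mul_ne_zero ?_ fun h0 => hφ i (by rw [h, h0, mul_zero])
  exact_mod_cast inv_ne_zero (norm_mulVecE_inv_ne_zero _ k φ)

/-- The density of the image of the measure with density `u` under the transition kernel. -/
noncomputable def imageDensity (u : StateSphere N → ℝ≥0∞) (φ : StateSphere N) : ℝ≥0∞ :=
  inverseProduct φ * ∑ k, u ((diagonal m hm hsum).invUpdate k φ) *
    (inverseProduct ((diagonal m hm hsum).invUpdate k φ))⁻¹ *
    ENNReal.ofReal ((diagonal m hm hsum).prob k ((diagonal m hm hsum).invUpdate k φ))

theorem measurable_weight (k : Fin K) {u : StateSphere N → ℝ≥0∞} (hu : Measurable u) :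
    Measurable fun φ => u φ * (inverseProduct φ)⁻¹ *
      ENNReal.ofReal ((diagonal m hm hsum).prob k φ) :=
  (hu.mul measurable_inverseProduct.inv).mul (continuous_prob _ k).measurable.ennreal_ofReal

theorem measurable_imageDensity {u : StateSphere N → ℝ≥0∞} (hu : Measurable u) :
    Measurable (imageDensity m hm hsum u) :=
  measurable_inverseProduct.mul (Finset.measurable_sum _ fun k _ =>
    (measurable_weight m hm hsum k hu).comp (continuous_invUpdate _ k).measurable)

/-- Writing `u σ` as `(u / ρ) ρ σ` and using invariance of `ρ σ` under each update moves `u p_k / ρ`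
to the inverse update, one branch at a time. -/
theorem comp_withDensity_eq {u : StateSphere N → ℝ≥0∞} (hu : Measurable u) :
    (diagonal m hm hsum).transition ∘ₘ (stateMeasure N).withDensity u =
      (stateMeasure N).withDensity (imageDensity m hm hsum u) := by
  refine Measure.ext fun A hA => ?_
  have hI : Measurable (A.indicator (1 : StateSphere N → ℝ≥0∞)) := measurable_one.indicator hA
  rw [← lintegral_indicator_one hA, ← lintegral_indicator_one hA,
    Measure.lintegral_bind (Kernel.aemeasurable _) hI.aemeasurable,
    lintegral_withDensity_eq_lintegral_mul _ hu hI.lintegral_kernel,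
    lintegral_withDensity_eq_lintegral_mul _ (measurable_imageDensity m hm hsum hu) hI]
  -- Inserting `ρ ρ⁻¹ = 1` requires `ρ` finite, hence only almost everywhere. Since `invUpdate k`
  -- undoes `update k`, each summand becomes `ρ` times a function of the updated state.
  have e1 : ∀ᵐ φ ∂stateMeasure N,
      (u * fun φ => ∫⁻ ψ, A.indicator 1 ψ ∂(diagonal m hm hsum).transition φ) φ =
      ∑ k, inverseProduct φ * (fun ψ => u ((diagonal m hm hsum).invUpdate k ψ) *
          (inverseProduct ((diagonal m hm hsum).invUpdate k ψ))⁻¹ *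
          ENNReal.ofReal ((diagonal m hm hsum).prob k ((diagonal m hm hsum).invUpdate k ψ)) *
          A.indicator 1 ψ) ((diagonal m hm hsum).update k φ) := by
    filter_upwards [ae_inverseProduct_ne_top] with φ hφ
    simp only [Pi.mul_apply]
    rw [lintegral_transition _ _ hI, Finset.mul_sum]
    refine Finset.sum_congr rfl fun k _ => ?_
    rw [invUpdate_update]
    have h1 : inverseProduct φ * (inverseProduct φ)⁻¹ = 1 :=
      ENNReal.mul_inv_cancel (inverseProduct_ne_zero φ) hφ
    calc u φ * (ENNReal.ofReal ((diagonal m hm hsum).prob k φ) *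
          A.indicator 1 ((diagonal m hm hsum).update k φ))
        = (inverseProduct φ * (inverseProduct φ)⁻¹) * (u φ *
          (ENNReal.ofReal ((diagonal m hm hsum).prob k φ) *
          A.indicator 1 ((diagonal m hm hsum).update k φ))) := by rw [h1, one_mul]
      _ = _ := by ring
  have hk : ∀ k, Measurable fun ψ => u ((diagonal m hm hsum).invUpdate k ψ) *
      (inverseProduct ((diagonal m hm hsum).invUpdate k ψ))⁻¹ *
      ENNReal.ofReal ((diagonal m hm hsum).prob k ((diagonal m hm hsum).invUpdate k ψ)) *
      A.indicator 1 ψ := fun k =>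
    ((measurable_weight m hm hsum k hu).comp (continuous_invUpdate _ k).measurable).mul hI
  rw [lintegral_congr_ae e1]
  refine (lintegral_finsetSum _ fun k _ =>
    measurable_inverseProduct.mul ((hk k).comp (continuous_update _ k).measurable)).trans ?_
  refine (Finset.sum_congr rfl fun k _ =>
    lintegral_inverseProduct_mul_comp_update m hm hsum k (hk k)).trans ?_
  refine (lintegral_finsetSum _ fun k _ => measurable_inverseProduct.mul (hk k)).symm.trans ?_
  refine lintegral_congr fun φ => ?_
  simp only [Pi.mul_apply, imageDensity]
  rw [mul_assoc, Finset.sum_mul, Finset.mul_sum]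

theorem comp_transition_absolutelyContinuous :
    (diagonal m hm hsum).transition ∘ₘ stateMeasure N ≪ stateMeasure N := by
  have h := comp_withDensity_eq m hm hsum measurable_one
  rw [withDensity_one] at h
  rw [h]
  exact withDensity_absolutelyContinuous _ _

theorem perronDensity_eq_imageDensity {u : StateSphere N → ℝ≥0∞} (hu : Measurable u) :
    perronDensity (stateMeasure N) (diagonal m hm hsum).transition u =ᵐ[stateMeasure N]
      imageDensity m hm hsum u := by
  rw [perronDensity, comp_withDensity_eq m hm hsum hu]
  exact Measure.rnDeriv_withDensity _ (measurable_imageDensity m hm hsum hu)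

end Diagonal

end QNDSystem

/-! ### The monotone extension of the operator through truncations. -/

section Truncation

variable {X : Type*} [MeasurableSpace X] {σ : Measure X} [SigmaFinite σ]

theorem measurable_truncation {u : X → ℝ≥0∞} (hu : Measurable u) (n : ℕ) :
    Measurable (truncation σ u n) :=
  (hu.min measurable_const).ennreal_toReal.indicator (measurableSet_spanningSets σ n)

theorem truncation_nonneg (u : X → ℝ≥0∞) (n : ℕ) (x : X) : 0 ≤ truncation σ u n x :=
  Set.indicator_nonneg (fun _ _ => ENNReal.toReal_nonneg) x

theorem ofReal_truncation_le (u : X → ℝ≥0∞) (n : ℕ) (x : X) :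
    ENNReal.ofReal (truncation σ u n x) ≤ u x := by
  rw [truncation]
  by_cases hx : x ∈ spanningSets σ n
  · rw [Set.indicator_of_mem hx]
    exact ENNReal.ofReal_toReal_le.trans (min_le_left _ _)
  · simp [Set.indicator_of_notMem hx]

/-- Equality, not mere convergence, lets one index serve finitely many points at once, so no
interchange of supremum and sum is needed. -/
theorem eventually_ofReal_truncation_eq {u : X → ℝ≥0∞} {x : X} (hx : u x ≠ ∞) :
    ∀ᶠ n in atTop, ENNReal.ofReal (truncation σ u n x) = u x := by
  have h1 : ∀ᶠ n in atTop, x ∈ spanningSets σ n :=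
    eventually_mem_spanningSets σ x
  obtain ⟨n₀, hn₀⟩ := ENNReal.exists_nat_gt hx
  filter_upwards [h1, eventually_ge_atTop n₀] with n h2 h3
  rw [truncation, Set.indicator_of_mem h2, min_eq_left (hn₀.le.trans (by exact_mod_cast h3)),
    ENNReal.ofReal_toReal hx]

theorem extend_frobeniusPerron_ae {κ : Kernel X X} [IsMarkovKernel κ] {u : X → ℝ≥0∞}
    (hu : AEMeasurable u σ) :
    (frobeniusPerron σ κ).extend u =ᵐ[σ] fun x =>
      ⨆ n, perronDensity σ κ (fun y => ENNReal.ofReal (truncation σ u n y)) x := by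
  have h : ∀ n, ∀ᵐ x ∂σ, ENNReal.ofReal ((frobeniusPerron σ κ).toCLM (truncationL1 σ u n) x) =
      perronDensity σ κ (fun y => ENNReal.ofReal (truncation σ u n y)) x := by
    intro n
    have hint := integrable_truncation σ hu n
    have h1 : perronDensity σ κ (fun y => ENNReal.ofReal (-truncation σ u n y)) =ᵐ[σ] 0 := by
      have h2 : (fun y => ENNReal.ofReal (-truncation σ u n y)) = 0 := by
        funext y
        simpa using truncation_nonneg u n y
      rw [h2, perronDensity, withDensity_zero]
      simp
    have h2 : perronFun σ κ (truncationL1 σ u n) = perronFun σ κ (truncation σ u n) := by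
      refine perronFun_congr ?_
      rw [truncationL1, dif_pos hu]
      exact hint.coeFn_toL1
    filter_upwards [coeFn_frobeniusPerron (κ := κ) (truncationL1 σ u n), h1,
      perronDensity_lt_top (κ := κ) (lintegral_ofReal_ne_top hint)] with x hx h3 h4
    rw [hx, h2, perronFun, h3, Pi.zero_apply, ENNReal.toReal_zero, sub_zero,
      ENNReal.ofReal_toReal h4.ne]
  filter_upwards [ae_all_iff.2 h] with x hx
  exact iSup_congr hx

end Truncation

/-! ### The image of `ρ` under the extended operator. -/

namespace QNDSystem

section Diagonal

variable {N K : ℕ} (m : Fin K → Fin N → ℝ) (hm : ∀ k i, m k i ∈ Set.Ioo (0 : ℝ) 1)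
  (hsum : ∀ i, ∑ k, m k i ^ 2 = 1)

theorem extend_perron_inverseProduct : ∀ᵐ φ ∂stateMeasure N,
    (diagonal m hm hsum).perron.extend inverseProduct φ =
      ENNReal.ofReal (∑ k, 1 / ‖mulVecE ((diagonal m hm hsum).M k)⁻¹ φ‖ ^ 2) *
        inverseProduct φ := by
  have h1 : ∀ n : ℕ, ∀ᵐ φ ∂stateMeasure N,
      perronDensity (stateMeasure N) (diagonal m hm hsum).transition
        (fun y => ENNReal.ofReal (truncation (stateMeasure N) inverseProduct n y)) φ =
      imageDensity m hm hsum
        (fun y => ENNReal.ofReal (truncation (stateMeasure N) inverseProduct n y)) φ := fun n =>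
    perronDensity_eq_imageDensity m hm hsum
      (measurable_truncation measurable_inverseProduct n).ennreal_ofReal
  filter_upwards [ae_all_iff.2 h1, extend_frobeniusPerron_ae
    (κ := (diagonal m hm hsum).transition) measurable_inverseProduct.aemeasurable,
    ae_apply_ne_zero] with φ h2 h3 h4
  have h5 : ∀ k, inverseProduct ((diagonal m hm hsum).invUpdate k φ) ≠ ∞ := fun k =>
    (inverseProduct_ne_top_iff _).2 (invUpdate_apply_ne_zero m hm hsum k h4)
  have h6 : imageDensity m hm hsum inverseProduct φ =
      ENNReal.ofReal (∑ k, 1 / ‖mulVecE ((diagonal m hm hsum).M k)⁻¹ φ‖ ^ 2) *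
        inverseProduct φ := by
    rw [imageDensity, mul_comm, ENNReal.ofReal_sum_of_nonneg fun k _ => by positivity]
    congr 1
    refine Finset.sum_congr rfl fun k _ => ?_
    rw [ENNReal.mul_inv_cancel (inverseProduct_ne_zero _) (h5 k), one_mul, prob_invUpdate]
  rw [← h6]
  change (frobeniusPerron (stateMeasure N) (diagonal m hm hsum).transition).extend
    inverseProduct φ = _
  rw [h3]
  simp_rw [h2]
  refine le_antisymm (iSup_le fun n => ?_) ?_
  · unfold imageDensity
    gcongr
    exact ofReal_truncation_le _ _ _
  -- The supremum is attained: for large `n` the truncation agrees with `ρ` at all the preimages of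
  -- `φ`, one for each `k`.
  · obtain ⟨n, hn⟩ := (eventually_all.2 fun k =>
      eventually_ofReal_truncation_eq (σ := stateMeasure N) (h5 k)).exists
    refine le_iSup_of_le n (le_of_eq ?_)
    unfold imageDensity
    simp_rw [hn]

end Diagonal

end QNDSystem

/-! ### Strict subinvariance and sweeping. -/

namespace QNDSystem

variable {N K : ℕ} (m : Fin K → Fin N → ℝ) (hm : ∀ k i, m k i ∈ Set.Ioo (0 : ℝ) 1)
  (hsum : ∀ i, ∑ k, m k i ^ 2 = 1)

/-- The strict inequality between the weighted harmonic and arithmetic means. -/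
theorem inv_sum_inv_mul_lt_sum_mul {ι : Type*} [Fintype ι] {t q : ι → ℝ} (ht : ∀ i, 0 < t i)
    (hq : ∀ i, 0 < q i) (hq1 : ∑ i, q i = 1) {i j : ι} (hij : t i ≠ t j) :
    1 / ∑ i, (t i)⁻¹ * q i < ∑ i, t i * q i := by
  have hne : (Finset.univ : Finset ι).Nonempty := ⟨i, Finset.mem_univ i⟩
  set a := ∑ i, t i * q i with ha
  have ha0 : 0 < a := Finset.sum_pos (fun i _ => mul_pos (ht i) (hq i)) hne
  have hb0 : 0 < ∑ i, (t i)⁻¹ * q i :=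
    Finset.sum_pos (fun i _ => mul_pos (inv_pos.2 (ht i)) (hq i)) hne
  -- The gap between `1 / t` and its tangent line at the mean `a`. The tangent line averages to `1 /
  -- a`, and the gap is positive at some `l` because the `t l` are not all equal.
  have hid : ∀ l, (t l)⁻¹ - (2 * a - t l) / a ^ 2 = (a - t l) ^ 2 / (a ^ 2 * t l) := fun l => by
    have := (ht l).ne'
    field_simp
    ring
  have hle : ∀ l, (2 * a - t l) / a ^ 2 ≤ (t l)⁻¹ := fun l => by
    have h1 : 0 ≤ (a - t l) ^ 2 / (a ^ 2 * t l) := by have := ht l; positivity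
    linarith [hid l]
  obtain ⟨l, hl⟩ : ∃ l, t l ≠ a := by
    by_contra! h
    exact hij ((h i).trans (h j).symm)
  have hlt : (2 * a - t l) / a ^ 2 < (t l)⁻¹ := by
    have h1 : 0 < (a - t l) ^ 2 / (a ^ 2 * t l) := by
      have := ht l
      have h2 : a - t l ≠ 0 := sub_ne_zero.2 hl.symm
      positivity
    linarith [hid l]
  have hs : ∑ i, (2 * a - t i) / a ^ 2 * q i < ∑ i, (t i)⁻¹ * q i :=
    Finset.sum_lt_sum (fun i _ => mul_le_mul_of_nonneg_right (hle i) (hq i).le)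
      ⟨l, Finset.mem_univ l, mul_lt_mul_of_pos_right hlt (hq l)⟩
  have he : ∑ i, (2 * a - t i) / a ^ 2 * q i = 1 / a := by
    have : ∀ i, (2 * a - t i) / a ^ 2 * q i = 2 / a * q i - 1 / a ^ 2 * (t i * q i) := fun i => by
      field_simp
    simp_rw [this]
    rw [Finset.sum_sub_distrib, ← Finset.mul_sum, ← Finset.mul_sum, hq1, ← ha]
    field_simp
    ring
  rw [he] at hs
  exact (one_div_lt ha0 hb0).1 hs

theorem norm_mulVecE_diagonal_sq (k : Fin K) (x : EuclideanSpace ℂ (Fin N)) :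
    ‖mulVecE ((diagonal m hm hsum).M k) x‖ ^ 2 = ∑ i, m k i ^ 2 * ‖x i‖ ^ 2 := by
  rw [EuclideanSpace.norm_sq_eq]
  refine Finset.sum_congr rfl fun i _ => ?_
  rw [mulVecE_diagonal_M, norm_mul, Complex.norm_real, mul_pow, Real.norm_eq_abs, sq_abs]

theorem norm_mulVecE_diagonal_inv_sq (k : Fin K) (x : EuclideanSpace ℂ (Fin N)) :
    ‖mulVecE ((diagonal m hm hsum).M k)⁻¹ x‖ ^ 2 = ∑ i, (m k i ^ 2)⁻¹ * ‖x i‖ ^ 2 := by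
  rw [EuclideanSpace.norm_sq_eq]
  refine Finset.sum_congr rfl fun i _ => ?_
  have h : x i = m k i * mulVecE ((diagonal m hm hsum).M k)⁻¹ x i := by
    rw [← mulVecE_diagonal_M m hm hsum, mulVecE_mulVecE_inv]
  have h0 := (hm k i).1.ne'
  rw [h, norm_mul, Complex.norm_real, mul_pow, Real.norm_eq_abs, sq_abs]
  field_simp

/-- Term by term, the `k`-th summand is a weighted harmonic mean strictly below the arithmetic mean
`p_k(φ)`. Nonvanishing coordinates make all weights positive, and coordinates `0` and `1` supply two
distinct values. -/
theorem sum_one_div_norm_inv_sq_lt_one (hN : 2 ≤ N) (hdist : ∀ k, Function.Injective (m k))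
    {φ : StateSphere N} (hφ : ∀ i, (φ : EuclideanSpace ℂ (Fin N)) i ≠ 0) :
    ∑ k, 1 / ‖mulVecE ((diagonal m hm hsum).M k)⁻¹ φ‖ ^ 2 < 1 := by
  have hK : (Finset.univ : Finset (Fin K)).Nonempty := by
    by_contra h
    have h1 := hsum ⟨0, by omega⟩
    rw [Finset.not_nonempty_iff_eq_empty.1 h] at h1
    simp at h1
  refine lt_of_lt_of_eq (Finset.sum_lt_sum_of_nonempty hK fun k _ => ?_)
    (sum_prob (diagonal m hm hsum) φ)
  rw [norm_mulVecE_diagonal_inv_sq, prob, norm_mulVecE_diagonal_sq]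
  refine inv_sum_inv_mul_lt_sum_mul (i := ⟨0, by omega⟩) (j := ⟨1, by omega⟩)
    (fun i => pow_pos (hm k i).1 2) (fun i => by have := hφ i; positivity) ?_ ?_
  · rw [← EuclideanSpace.norm_sq_eq, norm_eq_of_mem_sphere, one_pow]
  · intro h
    have h1 := hdist k ((pow_left_inj₀ (hm k _).1.le (hm k _).1.le two_ne_zero).1 h)
    simp at h1

theorem isProperlySubinvariant_inverseProduct (hN : 2 ≤ N)
    (hdist : ∀ k, Function.Injective (m k)) :
    (diagonal m hm hsum).perron.IsProperlySubinvariant inverseProduct where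
  aemeasurable := measurable_inverseProduct.aemeasurable
  finite := ae_inverseProduct_ne_top.mono fun _ h => h.lt_top
  lt := by
    filter_upwards [extend_perron_inverseProduct m hm hsum, ae_apply_ne_zero,
      ae_inverseProduct_ne_top] with φ h1 h2 h3
    rw [h1]
    conv_rhs => rw [← one_mul (inverseProduct φ)]
    exact ENNReal.mul_lt_mul_left (inverseProduct_ne_zero φ) h3
      (ENNReal.ofReal_lt_one.2 (sum_one_div_norm_inv_sq_lt_one m hm hsum hN hdist h2))

/-- AM–GM is strict in every term, and the arithmetic means sum to `1`. -/
theorem sum_mul_lt_one {m : Fin K → Fin N → ℝ} (hsum : ∀ i, ∑ k, m k i ^ 2 = 1) (i j : Fin N)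
    (hij : ∀ k, m k i ≠ m k j) :
    ∑ k, m k i * m k j < 1 := by
  have hK : (Finset.univ : Finset (Fin K)).Nonempty := by
    by_contra h
    have h1 := hsum i
    rw [Finset.not_nonempty_iff_eq_empty.1 h] at h1
    simp at h1
  have h : ∑ k, m k i * m k j < ∑ k, (m k i ^ 2 + m k j ^ 2) / 2 :=
    Finset.sum_lt_sum_of_nonempty hK fun k _ => by
      have : 0 < (m k i - m k j) ^ 2 := by
        have := sub_ne_zero.2 (hij k)
        positivity
      nlinarith
  rw [← Finset.sum_div, Finset.sum_add_distrib, hsum, hsum] at h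
  linarith

/-- The product of the moduli of two coordinates. -/
noncomputable def coordProduct (i j : Fin N) (φ : StateSphere N) : ℝ≥0∞ :=
  ENNReal.ofReal (‖(φ : EuclideanSpace ℂ (Fin N)) i‖ * ‖(φ : EuclideanSpace ℂ (Fin N)) j‖)

theorem measurable_coordProduct (i j : Fin N) : Measurable (coordProduct i j) := by
  unfold coordProduct
  fun_prop

theorem coordProduct_le_one (i j : Fin N) (φ : StateSphere N) : coordProduct i j φ ≤ 1 := by
  have h : ∀ i, ‖(φ : EuclideanSpace ℂ (Fin N)) i‖ ≤ 1 := fun i =>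
    (PiLp.norm_apply_le _ i).trans (norm_eq_of_mem_sphere φ).le
  exact ENNReal.ofReal_le_one.2 (mul_le_one₀ (h i) (norm_nonneg _) (h j))

/-- The product of the moduli of two coordinates is an eigenfunction of the transition kernel. -/
theorem lintegral_coordProduct_transition (i j : Fin N) (φ : StateSphere N) :
    ∫⁻ ψ, coordProduct i j ψ ∂(diagonal m hm hsum).transition φ =
      ENNReal.ofReal (∑ k, m k i * m k j) * coordProduct i j φ := by
  rw [lintegral_transition _ _ (measurable_coordProduct i j),
    ENNReal.ofReal_sum_of_nonneg fun k _ => mul_nonneg (hm k i).1.le (hm k j).1.le,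
    Finset.sum_mul]
  refine Finset.sum_congr rfl fun k _ => ?_
  -- The two normalising factors `‖M_k φ‖⁻¹` cancel the probability `‖M_k φ‖²` exactly; this is why
  -- a product of two moduli is used.
  have h0 : ‖mulVecE ((diagonal m hm hsum).M k) φ‖ ≠ 0 :=
    norm_ne_zero_iff.2 (mulVecE_ne_zero _ k φ)
  rw [coordProduct, coordProduct, prob, ← ENNReal.ofReal_mul (sq_nonneg _),
    ← ENNReal.ofReal_mul (mul_nonneg (hm k i).1.le (hm k j).1.le), norm_update_apply,
    norm_update_apply]
  congr 1
  field_simp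

/-- The set of states all of whose coordinates have modulus greater than `(n + 1)⁻¹`. -/
def interiorSet (N n : ℕ) : Set (StateSphere N) :=
  {φ | ∀ i, ((n : ℝ) + 1)⁻¹ < ‖(φ : EuclideanSpace ℂ (Fin N)) i‖}

theorem isOpen_interiorSet (N n : ℕ) : IsOpen (interiorSet N n) := by
  have h : interiorSet N n =
      ⋂ i, {φ : StateSphere N | ((n : ℝ) + 1)⁻¹ < ‖(φ : EuclideanSpace ℂ (Fin N)) i‖} := by
    ext φ
    simp [interiorSet]
  rw [h]
  exact isOpen_iInter_of_finite fun i => isOpen_lt continuous_const (by fun_prop)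

theorem monotone_interiorSet (N : ℕ) : Monotone (interiorSet N) := by
  intro a b hab φ hφ i
  refine lt_of_le_of_lt ?_ (hφ i)
  gcongr

theorem iUnion_interiorSet (N : ℕ) :
    ⋃ n, interiorSet N n = {φ : StateSphere N | ∃ i, (φ : EuclideanSpace ℂ (Fin N)) i = 0}ᶜ := by
  ext φ
  simp only [Set.mem_iUnion, Set.mem_compl_iff, Set.mem_ofPred_eq, not_exists]
  constructor
  · rintro ⟨n, hn⟩ i h0
    have h1 := hn i
    rw [h0, norm_zero] at h1
    exact absurd h1 (not_lt.2 (by positivity))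
  · intro h
    have h1 : ∀ i, ∀ᶠ n : ℕ in atTop, ((n : ℝ) + 1)⁻¹ < ‖(φ : EuclideanSpace ℂ (Fin N)) i‖ := by
      intro i
      have h2 := tendsto_one_div_add_atTop_nhds_zero_nat (𝕜 := ℝ)
      simp only [one_div] at h2
      exact h2.eventually (gt_mem_nhds (norm_pos_iff.2 (h i)))
    exact (eventually_all.2 h1).exists

theorem isSweepingTo (hN : 2 ≤ N) (hdist : ∀ k, Function.Injective (m k)) :
    (diagonal m hm hsum).perron.IsSweepingTo
      {φ | ∃ i, (φ : EuclideanSpace ℂ (Fin N)) i = 0} := by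
  let i₀ : Fin N := ⟨0, by omega⟩
  let i₁ : Fin N := ⟨1, by omega⟩
  have h01 : i₀ ≠ i₁ := by simp [i₀, i₁]
  -- A basis vector has a vanishing coordinate because `N ≥ 2`. The family is an increasing
  -- sequence, so a union of two members is the larger one.
  refine ⟨⟨⟨EuclideanSpace.single i₀ 1, by simp⟩, i₁, by simp [h01.symm]⟩,
    Set.range (interiorSet N), Set.countable_range _, ?_, ⟨?_, ?_, ?_, ?_⟩, ?_, ?_⟩
  · rintro _ ⟨n, rfl⟩
    exact isOpen_interiorSet N n
  · rintro _ ⟨n, rfl⟩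
    exact (isOpen_interiorSet N n).measurableSet
  · exact fun _ _ => measure_lt_top _ _
  · rintro _ ⟨a, rfl⟩ _ ⟨b, rfl⟩
    rcases le_total a b with h | h
    · exact ⟨b, (Set.union_eq_right.2 (monotone_interiorSet N h)).symm⟩
    · exact ⟨a, (Set.union_eq_left.2 (monotone_interiorSet N h)).symm⟩
  · refine ⟨interiorSet N, Set.mem_range_self, ?_⟩
    rw [iUnion_interiorSet, compl_compl]
    have h := ae_apply_ne_zero (N := N)
    rw [ae_iff] at h
    simpa using h
  · rw [Set.biInter_range, ← Set.compl_iUnion, iUnion_interiorSet, compl_compl]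
  · rintro _ ⟨n, rfl⟩ f
    have hc := sum_mul_lt_one hsum i₀ i₁ fun k h => h01 (hdist k h)
    have hn : (0 : ℝ) < ((n : ℝ) + 1)⁻¹ := by positivity
    refine tendsto_setIntegral_frobeniusPerron_pow (comp_transition_absolutelyContinuous m hm hsum)
      (measurable_coordProduct i₀ i₁) (coordProduct_le_one i₀ i₁) (ENNReal.ofReal_lt_one.2 hc)
      (fun φ => (lintegral_coordProduct_transition m hm hsum i₀ i₁ φ).le)
      (isOpen_interiorSet N n).measurableSet
      (δ := ENNReal.ofReal (((n : ℝ) + 1)⁻¹ * ((n : ℝ) + 1)⁻¹)) ?_ ENNReal.ofReal_ne_top ?_ f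
    · simpa using mul_pos hn hn
    · intro φ hφ
      exact ENNReal.ofReal_le_ofReal
        (mul_le_mul (hφ i₀).le (hφ i₁).le hn.le (norm_nonneg _))

end QNDSystem

end DualLyapunov

theorem mainTheorem6 {N K : ℕ} (hN : 2 ≤ N) (m : Fin K → Fin N → ℝ)
    (hm : ∀ k i, m k i ∈ Set.Ioo (0 : ℝ) 1) (hsum : ∀ i, ∑ k, m k i ^ 2 = 1)
    (hdist : ∀ k, Function.Injective (m k)) :
    (∀ (f : Lp ℝ 1 (stateMeasure N)) (A : Set (StateSphere N)), MeasurableSet A →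
      ∫ φ in A, (QNDSystem.diagonal m hm hsum).perron.toCLM f φ ∂(stateMeasure N) =
        ∫ φ, f φ * ((QNDSystem.diagonal m hm hsum).transition φ).real A ∂(stateMeasure N)) ∧
    (∀ᵐ φ ∂(stateMeasure N), (QNDSystem.diagonal m hm hsum).perron.extend inverseProduct φ =
      ENNReal.ofReal (∑ k, 1 / ‖mulVecE ((QNDSystem.diagonal m hm hsum).M k)⁻¹ φ‖ ^ 2) *
        inverseProduct φ) ∧
    (QNDSystem.diagonal m hm hsum).perron.IsProperlySubinvariant inverseProduct ∧
    (QNDSystem.diagonal m hm hsum).perron.IsSweepingTo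
      {φ | ∃ i, (φ : EuclideanSpace ℂ (Fin N)) i = 0} :=
  ⟨fun f _ hA => setIntegral_frobeniusPerron
      (QNDSystem.comp_transition_absolutelyContinuous m hm hsum) f hA,
    QNDSystem.extend_perron_inverseProduct m hm hsum,
    QNDSystem.isProperlySubinvariant_inverseProduct m hm hsum hN hdist,
    QNDSystem.isSweepingTo m hm hsum hN hdist⟩
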